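/- Let $G\subset GL(n,\mathbb R)$ be a matrix Lie group of dimension $m$ with identity $I$ and Lie algebra $\mathfrak g\subset\mathbb R^{n\times n}$. Let $\mathfrak g^\perp$ be the orthogonal complement of $\mathfrak g$ for $\langle A,B\rangle=\operatorname{trace}(A^TB)$, and let $v\mapsto v^{\parallel}\in\mathfrak g$, $v\mapsto v^{\perp}\in\mathfrak g^\perp$ be the orthogonal projections. Let $f:\mathfrak g\times\mathbb R^m\to\mathfrak g$ be $C^1$ with $\frac{\partial f}{\partial u}(\xi,u):\mathbb R^m\to\mathfrak g$ invertible for all $(\xi,u)$. Let $V:\mathbb R^{n\times n}\to[0,\infty)$ be a $C^2$ function with $V^{-1}(0)=G$, $V(xg)=V(x)$ for all $x\in\mathbb R^{n\times n}$, $g\in G$, and $\nabla^2V(I)\cdot(y,y)>0$ for all $y\in\mathfrak g^\perp\setminus\{0\}$; let $\alpha>0$. Let $(g_0,\xi_0):\mathbb R\to G\times\mathfrak g$ be a reference trajectory with continuous control $u_0:\mathbb R\to\mathbb R^m$, that is, $\dot g_0=g_0\xi_0$, $\dot\xi_0=f(\xi_0,u_0)$, and suppose that there are constants $\overline b\ge\underline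 b>0$ with $\underline b I\preceq g_0(t)g_0(t)^T\preceq\overline bI$ for all $t\in\mathbb R$. Write $P=(g_0g_0^T)^{-1}$. The split linearized error dynamics, with state $(Z^\perp,Z^\parallel,e)\in\mathfrak g^\perp\times\mathfrak g\times\mathfrak g$ and input $\delta u\in\mathbb R^m$, is $$\dot Z^{\perp}=-\alpha\big((\nabla^2V(I)\cdot Z^\perp)P\big)^\perp,\qquad \dot Z^{\parallel}=g_0eg_0^{-1}-\alpha\big((\nabla^2V(I)\cdot Z^\perp)P\big)^\parallel,\qquad \dot e=\tfrac{\partial f}{\partial\xi}(\xi_0,u_0)e+\tfrac{\partial f}{\partial u}(\xi_0,u_0)\delta u .$$ The nonlinear tracking error dynamics, with state $(Z,e)\in\mathbb R^{n\times n}\times\mathfrak g$ and input $u$, is $$\dot Z=(g_0+Zg_0)\,e\,g_0^{-1}-\alpha\nabla V(g_0+Zg_0)g_0^{-1},\qquad \dot e=f(e+\xi_0,u)-f(\xi_0,u_0).$$ Let $K_p,K_d\in\mathbb R^{n\times n}$ be such that left multiplication by each of them maps $\mathfrak g$ into $\mathfrak g$ and such that $\begin{pmatrix}0&I\\K_p&K_d\end{pmatrix}$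 is Hurwitz. Put $$W=-\alpha\big((\nabla^2V(I)\cdot Z^\perp)P\big)^\parallel,\qquad Y=g_0^{-1}\big(-\dot W+K_pZ^\parallel+K_d(g_0eg_0^{-1}+W)\big)g_0,$$ $$\delta u=\Big(\tfrac{\partial f}{\partial u}(\xi_0,u_0)\Big)^{-1}\Big\{[e,\xi_0]+Y-\tfrac{\partial f}{\partial\xi}(\xi_0,u_0)e\Big\},$$ where $\dot W$ denotes the function of $(t,Z^\perp)$ given by $$\dot W=-\alpha\big((\nabla^2V(I)\cdot\dot Z^\perp)P+(\nabla^2V(I)\cdot Z^\perp)\dot P\big)^\parallel,\quad \dot Z^\perp=-\alpha\big((\nabla^2V(I)\cdot Z^\perp)P\big)^\perp,\quad \dot P=-P\,g_0(\xi_0+\xi_0^T)g_0^T\,P.$$ Then: (1) the split linearized error dynamics with the feedback $\delta u$ is exponentially stable to zero: there are $k,\lambda>0$ such that for every initial time $t_0$ and initial state there is a solution on $[t_0,\infty)$, and every solution $x$ satisfies $\|x(t)\|\le k\|x(t_0)\|e^{-\lambda(t-t_0)}$ as long as it exists. (2) Along every solution of the $Z^\perp$-equation, the expression $\dot W$ above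 is indeed the time derivative of $W$. (3) If moreover $\xi_0$ and $u_0$ are bounded, then the control $u=u_0+\delta u$ (with $Z^\perp,Z^\parallel$ the two projections of $Z$) exponentially stabilizes the nonlinear tracking error dynamics to zero: there are $c,k,\lambda>0$ such that for every $t_0$ and every initial state of norm less than $c$ the conclusion of (1) holds for the nonlinear closed-loop system. -/

import Mathlib

open scoped Matrix ContDiff Matrix.Norms.Frobenius

namespace LieTracking

noncomputable section

/-- Real `n × n` matrices, with the Frobenius norm (the Euclidean norm of the trace metric). -/
abbrev Mat (n : ℕ) : Type := Matrix (Fin n) (Fin n) ℝ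

/-- Controls `u ∈ ℝᵐ`. -/
abbrev Ctrl (m : ℕ) : Type := EuclideanSpace ℝ (Fin m)

/-- The matrix of an element of a group of invertible matrices. -/
def mat {n : ℕ} {G : Subgroup (GL (Fin n) ℝ)} (g : G) : Mat n := ((g : GL (Fin n) ℝ) : Mat n)

lemma mat_mul_inv {n : ℕ} {G : Subgroup (GL (Fin n) ℝ)} (g : G) : mat g * mat g⁻¹ = 1 := by
  simp [mat]

lemma mat_inv_mul {n : ℕ} {G : Subgroup (GL (Fin n) ℝ)} (g : G) : mat g⁻¹ * mat g = 1 := by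
  simp [mat]

/-! ### The Lie algebra and the orthogonal splitting of the matrix space -/

/-- The Lie algebra of `G`: the tangent space at the identity, that is, the velocities at `0` of
smooth curves of matrices that stay in `G` and pass through the identity at time `0`. -/
def lieAlg {n : ℕ} (G : Subgroup (GL (Fin n) ℝ)) : Submodule ℝ (Mat n) where
  carrier := {A | ∃ γ : ℝ → Mat n, ContDiff ℝ ∞ γ ∧ (∀ t, ∃ g : G, mat g = γ t) ∧
    γ 0 = 1 ∧ HasDerivAt γ A 0}
  zero_mem' := ⟨fun _ => 1, contDiff_const, fun _ => ⟨1, by simp [mat]⟩, rfl,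
    hasDerivAt_const _ _⟩
  add_mem' := by
    rintro A B ⟨γ, hγ, hγG, hγ0, hγ'⟩ ⟨δ, hδ, hδG, hδ0, hδ'⟩
    refine ⟨fun t => γ t * δ t, hγ.mul hδ, fun t => ?_, by simp [hγ0, hδ0], ?_⟩
    · obtain ⟨g, hg⟩ := hγG t
      obtain ⟨h, hh⟩ := hδG t
      exact ⟨g * h, by simp [mat, ← hg, ← hh]⟩
    · have h := hγ'.mul hδ'
      rw [hγ0, hδ0, mul_one, one_mul] at h
      exact h
  smul_mem' := by
    rintro c A ⟨γ, hγ, hγG, hγ0, hγ'⟩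
    refine ⟨fun t => γ (c * t), hγ.comp (contDiff_const.mul contDiff_id), fun t => hγG _,
      by simp [hγ0], ?_⟩
    have h1 : HasDerivAt (fun t : ℝ => c * t) c 0 := by
      simpa using (hasDerivAt_id (0 : ℝ)).const_mul c
    have h2 : HasDerivAt γ A (c * 0) := by simpa using hγ'
    exact h2.scomp (0 : ℝ) h1

/-- The Euclidean metric `⟨A, B⟩ = trace (Aᵀ B)`. -/
def frob (n : ℕ) : LinearMap.BilinForm ℝ (Mat n) :=
  LinearMap.mk₂ ℝ (fun A B => (Aᵀ * B).trace)
    (fun A A' B => by simp [Matrix.add_mul])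
    (fun c A B => by simp)
    (fun A B B' => by simp [Matrix.mul_add])
    (fun c A B => by simp)

lemma frob_apply {n : ℕ} (A B : Mat n) : frob n A B = (Aᵀ * B).trace := rfl

lemma frob_symm {n : ℕ} (A B : Mat n) : frob n A B = frob n B A := by
  rw [frob_apply, frob_apply, ← Matrix.trace_transpose (Aᵀ * B), Matrix.transpose_mul,
    Matrix.transpose_transpose]

lemma frob_self_eq_zero {n : ℕ} {A : Mat n} (h : frob n A A = 0) : A = 0 := by
  rw [frob_apply] at h
  exact Matrix.trace_conjTranspose_mul_self_eq_zero_iff.1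
    (by simpa [Matrix.conjTranspose_eq_transpose_of_trivial] using h)

/-- The orthogonal complement `𝔤^⊥` of the Lie algebra under the trace metric. -/
def perp {n : ℕ} (G : Subgroup (GL (Fin n) ℝ)) : Submodule ℝ (Mat n) :=
  (frob n).orthogonal (lieAlg G)

lemma isCompl_perp {n : ℕ} (G : Subgroup (GL (Fin n) ℝ)) : IsCompl (lieAlg G) (perp G) := by
  have hr : (frob n).IsRefl := fun A B h => by rw [frob_symm, h]
  refine (LinearMap.BilinForm.isCompl_orthogonal_iff_disjoint hr).2 ?_
  rw [Submodule.disjoint_def]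
  intro A hA hA'
  exact frob_self_eq_zero (hA' A hA)

/-- The orthogonal projection `v ↦ v^∥` onto the Lie algebra. -/
def prl {n : ℕ} (G : Subgroup (GL (Fin n) ℝ)) : Mat n →ₗ[ℝ] lieAlg G :=
  (lieAlg G).projectionOnto (perp G) (isCompl_perp G)

/-- The orthogonal projection `v ↦ v^⊥` onto `𝔤^⊥`. -/
def prp {n : ℕ} (G : Subgroup (GL (Fin n) ℝ)) : Mat n →ₗ[ℝ] perp G :=
  (perp G).projectionOnto (lieAlg G) (isCompl_perp G).symm

lemma mem_lieAlg_of_prp_eq_zero {n : ℕ} {G : Subgroup (GL (Fin n) ℝ)} {A : Mat n}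
    (h : prp G A = 0) : A ∈ lieAlg G := by
  have : A ∈ LinearMap.ker (prp G) := h
  rwa [prp, Submodule.ker_projectionOnto] at this

lemma Ad_mem {n : ℕ} {G : Subgroup (GL (Fin n) ℝ)} (g : G) {A : Mat n} (hA : A ∈ lieAlg G) :
    mat g * A * mat g⁻¹ ∈ lieAlg G := by
  obtain ⟨γ, hγ, hγG, hγ0, hγ'⟩ := hA
  refine ⟨fun t => mat g * γ t * mat g⁻¹, (contDiff_const.mul hγ).mul contDiff_const,
    fun t => ?_, ?_, (hγ'.const_mul _).mul_const _⟩
  · obtain ⟨h, hh⟩ := hγG t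
    exact ⟨g * h * g⁻¹, by simp [mat, ← hh]⟩
  · simp [hγ0, mat_mul_inv]

/-- `A ↦ g A g⁻¹` on the Lie algebra. -/
def Ad {n : ℕ} {G : Subgroup (GL (Fin n) ℝ)} (g : G) : lieAlg G →ₗ[ℝ] lieAlg G where
  toFun A := ⟨mat g * A * mat g⁻¹, Ad_mem g A.2⟩
  map_add' A B := by ext1; simp [mul_add, add_mul]
  map_smul' c A := by ext1; simp

lemma bracket_mem {n : ℕ} {G : Subgroup (GL (Fin n) ℝ)} {A B : Mat n} (hA : A ∈ lieAlg G)
    (hB : B ∈ lieAlg G) : A * B - B * A ∈ lieAlg G := by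
  obtain ⟨γ, -, hγG, hγ0, hγ'⟩ := hA
  have hinv : HasDerivAt (fun t => Ring.inverse (γ t)) (-A) 0 := by
    have h1 : HasFDerivAt Ring.inverse
        (-(ContinuousLinearMap.mulLeftRight ℝ (Mat n)) 1 1) (γ 0) := by
      rw [hγ0]
      simpa using hasFDerivAt_ringInverse (𝕜 := ℝ) (1 : (Mat n)ˣ)
    have h2 := h1.comp_hasDerivAt (0 : ℝ) hγ'
    simp only [neg_apply, ContinuousLinearMap.mulLeftRight_apply, one_mul,
      mul_one] at h2
    exact h2
  have hd : HasDerivAt (fun t => γ t * B * Ring.inverse (γ t)) (A * B - B * A) 0 := by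
    have h := (hγ'.mul_const B).mul hinv
    simp only [hγ0, Ring.inverse_one, mul_one, one_mul, mul_neg, ← sub_eq_add_neg] at h
    exact h
  have hz : ∀ t, prp G (γ t * B * Ring.inverse (γ t)) = 0 := by
    intro t
    obtain ⟨g, hg⟩ := hγG t
    have hi : Ring.inverse (γ t) = mat g⁻¹ := by
      rw [← hg]
      have : mat g = ((g : GL (Fin n) ℝ) : Mat n) := rfl
      rw [this, Ring.inverse_unit]
      rfl
    have hm := Ad_mem g hB
    rw [hi, ← hg]
    have : mat g * B * mat g⁻¹ ∈ LinearMap.ker (prp G) := by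
      rwa [prp, Submodule.ker_projectionOnto]
    exact this
  have h0 := (LinearMap.toContinuousLinearMap (prp G)).hasFDerivAt.comp_hasDerivAt (0 : ℝ) hd
  have h1 : ((LinearMap.toContinuousLinearMap (prp G)) ∘
      fun t => γ t * B * Ring.inverse (γ t)) = fun _ => 0 := funext hz
  rw [h1] at h0
  exact mem_lieAlg_of_prp_eq_zero (h0.unique (hasDerivAt_const _ _))

/-- The commutator `[A, B] = A B - B A` on the Lie algebra. -/
def bracket {n : ℕ} {G : Subgroup (GL (Fin n) ℝ)} (A B : lieAlg G) : lieAlg G :=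
  ⟨(A : Mat n) * B - B * A, bracket_mem A.2 B.2⟩

/-- Left multiplication by a matrix `K` with `K 𝔤 ⊆ 𝔤`, as a linear map of `𝔤`. -/
def leftMul {n : ℕ} {G : Subgroup (GL (Fin n) ℝ)} (K : Mat n)
    (hK : ∀ X ∈ lieAlg G, K * X ∈ lieAlg G) : lieAlg G →ₗ[ℝ] lieAlg G where
  toFun X := ⟨K * X, hK X X.2⟩
  map_add' A B := by ext1; simp [mul_add]
  map_smul' c A := by ext1; simp

/-! ### The function `V` -/

/-- The gradient of `V` with respect to the metric `trace (Aᵀ B)`: the matrix of the partial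
derivatives of `V` with respect to the entries. -/
def grad {n : ℕ} (V : Mat n → ℝ) (x : Mat n) : Mat n :=
  Matrix.of fun i j => fderiv ℝ V x (Matrix.single i j 1)

/-- The Hessian operator `v ↦ ∇²V(x) · v`, the derivative of the gradient. -/
def hess {n : ℕ} (V : Mat n → ℝ) (x : Mat n) : Mat n →L[ℝ] Mat n := fderiv ℝ (grad V) x

/-- `V ≥ 0` is a `C²` function on the matrix space with zero set `G`, invariant under right
translations by `G`, and its Hessian at the identity is positive definite on `𝔤^⊥`. -/
structure IsTransversal {n : ℕ} (G : Subgroup (GL (Fin n) ℝ)) (V : Mat n → ℝ) : Prop where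
  contDiff : ContDiff ℝ 2 V
  nonneg : ∀ x, 0 ≤ V x
  zero_iff : ∀ x, V x = 0 ↔ ∃ g : G, mat g = x
  invariant : ∀ (x : Mat n) (g : G), V (x * mat g) = V x
  posDef : ∀ y ∈ perp G, y ≠ 0 → 0 < frob n (hess V 1 y) y

/-! ### Stability -/

/-- `M` is Hurwitz: all its complex eigenvalues have negative real part. -/
def IsHurwitz {ι : Type} [Fintype ι] [DecidableEq ι] (M : Matrix ι ι ℝ) : Prop :=
  ∀ μ ∈ spectrum ℂ (M.map (fun r : ℝ => (r : ℂ))), μ.re < 0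

/-- `x` solves `ẋ = F(t, x)` on `s` (one-sided derivatives at end points). -/
def IsSolOn {E : Type} [NormedAddCommGroup E] [NormedSpace ℝ E] (F : ℝ → E → E) (x : ℝ → E)
    (s : Set ℝ) : Prop :=
  ∀ t ∈ s, HasDerivWithinAt x (F t (x t)) s t

/-- From the state `x₀` at time `t₀`, `ẋ = F(t, x)` has a solution for all `t ≥ t₀`, and every
solution, for as long as it exists, satisfies `‖x(t)‖ ≤ k ‖x₀‖ exp(-l (t - t₀))`. -/
def DecaysFrom {E : Type} [NormedAddCommGroup E] [NormedSpace ℝ E] (F : ℝ → E → E) (k l t₀ : ℝ)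
    (x₀ : E) : Prop :=
  (∃ x : ℝ → E, x t₀ = x₀ ∧ IsSolOn F x (Set.Ici t₀)) ∧
    ∀ (T : ℝ) (x : ℝ → E), x t₀ = x₀ → IsSolOn F x (Set.Icc t₀ T) →
      ∀ t ∈ Set.Icc t₀ T, ‖x t‖ ≤ k * ‖x₀‖ * Real.exp (-l * (t - t₀))

/-- Exponential stability to zero of `ẋ = F(t, x)`, for all initial states, uniformly in the
initial time (the notion used for linear systems). -/
def GloballyExpStable {E : Type} [NormedAddCommGroup E] [NormedSpace ℝ E] (F : ℝ → E → E) :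
    Prop :=
  ∃ k > 0, ∃ l > 0, ∀ (t₀ : ℝ) (x₀ : E), DecaysFrom F k l t₀ x₀

/-- Exponential stability of the zero state of the nonlinear time-varying system `ẋ = F(t, x)`:
exponential decay from all initial states in some ball, uniformly in the initial time. -/
def ExpStable {E : Type} [NormedAddCommGroup E] [NormedSpace ℝ E] (F : ℝ → E → E) : Prop :=
  ∃ c > 0, ∃ k > 0, ∃ l > 0, ∀ (t₀ : ℝ) (x₀ : E), ‖x₀‖ < c → DecaysFrom F k l t₀ x₀

/-! ### The reference trajectory and the error dynamics -/

section Dynamics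

variable {n m : ℕ} {G : Subgroup (GL (Fin n) ℝ)}

/-- `(g₀, ξ₀)` is a trajectory of `ġ = g ξ`, `ξ̇ = f(ξ, u)` for the continuous control `u₀`. -/
structure IsReference (f : lieAlg G → Ctrl m → lieAlg G) (g₀ : ℝ → G) (ξ₀ : ℝ → lieAlg G)
    (u₀ : ℝ → Ctrl m) : Prop where
  continuous_u : Continuous u₀
  deriv_g : ∀ t, HasDerivAt (fun s => mat (g₀ s)) (mat (g₀ t) * (ξ₀ t : Mat n)) t
  deriv_ξ : ∀ t, HasDerivAt ξ₀ (f (ξ₀ t) (u₀ t)) t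

/-- `∂f/∂ξ (ξ, u)`. -/
def dfdξ (f : lieAlg G → Ctrl m → lieAlg G) (ξ : lieAlg G) (u : Ctrl m) :
    lieAlg G →L[ℝ] lieAlg G := fderiv ℝ (fun ζ => f ζ u) ξ

/-- `∂f/∂u (ξ, u)`. -/
def dfdu (f : lieAlg G → Ctrl m → lieAlg G) (ξ : lieAlg G) (u : Ctrl m) :
    Ctrl m →L[ℝ] lieAlg G := fderiv ℝ (fun v => f ξ v) u

/-- `(g₀ g₀ᵀ)⁻¹`. -/
def gramInv (g₀ : ℝ → G) (t : ℝ) : Mat n := (mat (g₀ t) * (mat (g₀ t))ᵀ)⁻¹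

/-- The time derivative of `(g₀ g₀ᵀ)⁻¹`, by `ġ₀ = g₀ ξ₀`. -/
def gramInvDot (g₀ : ℝ → G) (ξ₀ : ℝ → lieAlg G) (t : ℝ) : Mat n :=
  -(gramInv g₀ t * (mat (g₀ t) * (ξ₀ t : Mat n) * (mat (g₀ t))ᵀ
      + mat (g₀ t) * (ξ₀ t : Mat n)ᵀ * (mat (g₀ t))ᵀ) * gramInv g₀ t)

/-- The transversal dynamics `η̇ = -α ((∇²V(I) · η) (g₀ g₀ᵀ)⁻¹)^⊥`. -/
def perpField (V : Mat n → ℝ) (α : ℝ) (g₀ : ℝ → G) (t : ℝ) (η : perp G) : perp G :=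
  -(α • prp G (hess V 1 (η : Mat n) * gramInv g₀ t))

/-- `W = -α ((∇²V(I) · η) (g₀ g₀ᵀ)⁻¹)^∥`. -/
def W (V : Mat n → ℝ) (α : ℝ) (g₀ : ℝ → G) (t : ℝ) (η : perp G) : lieAlg G :=
  -(α • prl G (hess V 1 (η : Mat n) * gramInv g₀ t))

/-- `Ẇ` as a function of the state, by the transversal dynamics and `ġ₀ = g₀ ξ₀`. -/
def Wdot (V : Mat n → ℝ) (α : ℝ) (g₀ : ℝ → G) (ξ₀ : ℝ → lieAlg G) (t : ℝ) (η : perp G) :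
    lieAlg G :=
  -(α • prl G (hess V 1 (perpField V α g₀ t η : Mat n) * gramInv g₀ t
      + hess V 1 (η : Mat n) * gramInvDot g₀ ξ₀ t))

/-- `Y = g₀⁻¹ (-Ẇ + K_p z + K_d (g₀ e g₀⁻¹ + W)) g₀`, for the transversal error `η`, the parallel
error `z` and the velocity error `e`. -/
def Y (V : Mat n → ℝ) (α : ℝ) (g₀ : ℝ → G) (ξ₀ : ℝ → lieAlg G) (Kp Kd : lieAlg G →ₗ[ℝ] lieAlg G)
    (t : ℝ) (η : perp G) (z e : lieAlg G) : lieAlg G :=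
  Ad (g₀ t)⁻¹ (-Wdot V α g₀ ξ₀ t η + Kp z + Kd (Ad (g₀ t) e + W V α g₀ t η))

/-- The feedback `δu = (∂f/∂u)⁻¹ ([e, ξ₀] + Y - (∂f/∂ξ) e)`, with the partial derivatives taken at
`(ξ₀, u₀)`. -/
def feedback (f : lieAlg G → Ctrl m → lieAlg G) (V : Mat n → ℝ) (α : ℝ) (g₀ : ℝ → G)
    (ξ₀ : ℝ → lieAlg G) (u₀ : ℝ → Ctrl m) (Kp Kd : lieAlg G →ₗ[ℝ] lieAlg G)
    (t : ℝ) (η : perp G) (z e : lieAlg G) : Ctrl m :=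
  (dfdu f (ξ₀ t) (u₀ t)).inverse
    (bracket e (ξ₀ t) + Y V α g₀ ξ₀ Kp Kd t η z e - dfdξ f (ξ₀ t) (u₀ t) e)

/-- The split linearized error dynamics in the state `(η, z, e)` with control increment
`δu = κ(t, η, z, e)`. -/
def splitField (f : lieAlg G → Ctrl m → lieAlg G) (V : Mat n → ℝ) (α : ℝ) (g₀ : ℝ → G)
    (ξ₀ : ℝ → lieAlg G) (u₀ : ℝ → Ctrl m)
    (κ : ℝ → perp G → lieAlg G → lieAlg G → Ctrl m)
    (t : ℝ) (x : perp G × lieAlg G × lieAlg G) : perp G × lieAlg G × lieAlg G :=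
  (perpField V α g₀ t x.1,
    Ad (g₀ t) x.2.2 - α • prl G (hess V 1 (x.1 : Mat n) * gramInv g₀ t),
    dfdξ f (ξ₀ t) (u₀ t) x.2.2 + dfdu f (ξ₀ t) (u₀ t) (κ t x.1 x.2.1 x.2.2))

/-- The nonlinear tracking error dynamics in the state `(Z, e)`, where `Z = x g₀⁻¹ - I` is an
arbitrary matrix, with control `u = u₀ + δu`, `δu = κ(t, Z^⊥, Z^∥, e)`. -/
def errorField (f : lieAlg G → Ctrl m → lieAlg G) (V : Mat n → ℝ) (α : ℝ) (g₀ : ℝ → G)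
    (ξ₀ : ℝ → lieAlg G) (u₀ : ℝ → Ctrl m)
    (κ : ℝ → perp G → lieAlg G → lieAlg G → Ctrl m)
    (t : ℝ) (x : Mat n × lieAlg G) : Mat n × lieAlg G :=
  ((mat (g₀ t) + x.1 * mat (g₀ t)) * (x.2 : Mat n) * mat (g₀ t)⁻¹
      - α • (grad V (mat (g₀ t) + x.1 * mat (g₀ t)) * mat (g₀ t)⁻¹),
    f (x.2 + ξ₀ t) (u₀ t + κ t (prp G x.1) (prl G x.1) x.2) - f (ξ₀ t) (u₀ t))

end Dynamics

end

end LieTracking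

/-!
The right invariance of `V` turns the gradient term of the error dynamics into `∇V(I + Z) P` with
`P = (g₀ g₀ᵀ)⁻¹`. As `V` is minimal on `G`, its Hessian `H` at the identity kills `𝔤`, and being
symmetric it maps into `𝔤^⊥`; so the linearization of the error dynamics at `0` splits, and the
result is the split dynamics (`splitState_fderiv_errorMap`).

In the coordinates `(η, z, ω)` with `ω = g₀ e g₀⁻¹ + W`, the velocity of `z`, the feedback cancels
every time-varying term of the second and third equations: the closed loop becomes
`η̇ = -α ((H η) P)^⊥`, `ż = ω`, `ω̇ = K_p z + K_d ω` (`coordVel_splitField`). These coordinates are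
uniformly equivalent to the original ones, because `g₀` and `g₀⁻¹` are bounded
(`exists_norm_coord_le`). The function `⟨η, H η⟩` decays along the first equation, since
`⟨H η, (H η P)^⊥⟩ = ‖H η g₀⁻ᵀ‖²`, and for the other two the Hurwitz matrix has a Lyapunov matrix
(`exists_lyapunov_of_isHurwitz`). The sum of the two is a quadratic Lyapunov function, uniform in
time, that tolerates small relative perturbations of the velocity (`exists_lyapunov_splitField`).

Without perturbation this gives the stability of the split dynamics. When `ξ₀` and `u₀` are bounded,
the nonlinear field is a `C¹` function of the state and of parameters in a bounded set, so its
first-order remainder is uniformly small near `0` (`exists_uniform_linearization`), and the same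
Lyapunov function proves the nonlinear claim (`expStable_of_lyapunov_linearization`). Solutions
exist for all future times because they stay in a ball (`decaysFrom_of_lyapunov`).
-/

namespace LieTracking

/-! ### Lyapunov matrices of Hurwitz matrices -/

/-- The Cayley transform `(a + 1) (a - 1)⁻¹` maps the open left half plane to the open unit disc;
here `b` is the inverse of `a - 1`. -/
lemma norm_lt_one_of_mem_spectrum_cayley {A : Type*} [Ring A] [Algebra ℂ A] {a b : A}
    (ha : ∀ μ ∈ spectrum ℂ a, μ.re < 0) (h1 : (a - 1) * b = 1) (h2 : b * (a - 1) = 1)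
    {z : ℂ} (hz : z ∈ spectrum ℂ ((a + 1) * b)) : ‖z‖ < 1 := by
  have hb : IsUnit b := ⟨⟨b, a - 1, h2, h1⟩, rfl⟩
  rcases eq_or_ne z 1 with rfl | hz1
  · exfalso
    apply hz
    have : algebraMap ℂ A 1 - (a + 1) * b = algebraMap ℂ A (-2) * b := by
      calc algebraMap ℂ A 1 - (a + 1) * b = (a - 1) * b - (a + 1) * b := by rw [h1, map_one]
        _ = _ := by simp only [map_neg, map_ofNat]; noncomm_ring
    rw [spectrum.mem_resolventSet_iff, this]
    exact ((IsUnit.mk0 (-2 : ℂ) (by norm_num)).map (algebraMap ℂ A)).mul hb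
  · have hz1' : z - 1 ≠ 0 := sub_ne_zero.2 hz1
    have hmem : (z + 1) / (z - 1) ∈ spectrum ℂ a := by
      intro hu
      apply hz
      have : algebraMap ℂ A z - (a + 1) * b
          = algebraMap ℂ A (1 - z) * (algebraMap ℂ A ((z + 1) / (z - 1)) - a) * b := by
        have e1 : algebraMap ℂ A (1 - z) * algebraMap ℂ A ((z + 1) / (z - 1))
            = - algebraMap ℂ A z - 1 := by
          rw [← map_mul]
          have : (1 - z) * ((z + 1) / (z - 1)) = - z - 1 := by field_simp; ring
          rw [this]; simp
        rw [mul_sub, e1]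
        calc algebraMap ℂ A z - (a + 1) * b
            = algebraMap ℂ A z * ((a - 1) * b) - (a + 1) * b := by rw [h1, mul_one]
          _ = _ := by simp only [map_sub, map_one]; noncomm_ring
      rw [spectrum.mem_resolventSet_iff, this]
      exact (((IsUnit.mk0 (1 - z) (sub_ne_zero.2 hz1.symm)).map (algebraMap ℂ A)).mul hu).mul hb
    have h := ha _ hmem
    have hpos : 0 < Complex.normSq (z - 1) := Complex.normSq_pos.2 hz1'
    have hre : ((z + 1) / (z - 1)).re = (Complex.normSq z - 1) / Complex.normSq (z - 1) := by
      rw [Complex.div_re, Complex.normSq_apply z]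
      simp
      ring
    rw [hre, div_neg_iff] at h
    have h3 : Complex.normSq z < 1 := by
      rcases h with h | h <;> linarith
    rw [Complex.normSq_eq_norm_sq] at h3
    nlinarith [norm_nonneg z]

/-- By Gelfand's formula, the squared norms of the powers of an element are summable if its
spectrum lies in the open unit disc. -/
lemma summable_norm_pow_sq_of_spectrum {A : Type*} [NormedRing A] [NormedAlgebra ℂ A]
    [CompleteSpace A] {a : A} (ha : ∀ z ∈ spectrum ℂ a, ‖z‖ < 1) :
    Summable fun k => ‖a ^ k‖ ^ 2 := by
  rcases subsingleton_or_nontrivial A with hA | hA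
  · have : (fun k => ‖a ^ k‖ ^ 2) = fun _ => 0 := by
      ext k; rw [Subsingleton.elim (a ^ k) 0]; simp
    rw [this]; exact summable_zero
  have hr : spectralRadius ℂ a < (1 : NNReal) :=
    spectrum.spectralRadius_lt_of_forall_lt a fun z hz => by
      have := ha z hz
      exact_mod_cast this
  obtain ⟨r, hr1, hr2⟩ := ENNReal.lt_iff_exists_nnreal_btwn.1 hr
  have hr2' : r < 1 := by exact_mod_cast hr2
  have hev := (spectrum.pow_nnnorm_pow_one_div_tendsto_nhds_spectralRadius
    a).eventually_lt_const hr1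
  have hev2 : ∀ᶠ k : ℕ in Filter.atTop, ‖‖a ^ k‖ ^ 2‖ ≤ ((r : ℝ) ^ 2) ^ k := by
    filter_upwards [hev, Filter.eventually_gt_atTop 0] with k hk hk0
    have h1 : (‖a ^ k‖₊ : ENNReal) ≤ (r : ENNReal) ^ k := by
      have := ENNReal.rpow_le_rpow hk.le (Nat.cast_nonneg (α := ℝ) k)
      rw [← ENNReal.rpow_mul, one_div, inv_mul_cancel₀ (by positivity), ENNReal.rpow_one,
        ENNReal.rpow_natCast] at this
      exact this
    have h2 : ‖a ^ k‖ ≤ (r : ℝ) ^ k := by exact_mod_cast h1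
    rw [Real.norm_of_nonneg (by positivity), pow_right_comm]
    gcongr
  refine Summable.of_norm_bounded_eventually_nat (g := fun k => ((r : ℝ) ^ 2) ^ k) ?_ hev2
  refine summable_geometric_of_lt_one (by positivity) ?_
  have : (r : ℝ) < 1 := by exact_mod_cast hr2'
  have h0 : (0 : ℝ) ≤ r := r.2
  nlinarith

/-- The Lyapunov equation `Mᵀ S + S M = -Nᵀ N` of a Hurwitz matrix has a solution `S ≥ I` with
injective `N`: for the Cayley transform `A` of `M`, take `S = ∑ (Aᵏ)ᵀ Aᵏ`, which converges
and solves `S = I + Aᵀ S A`. -/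
lemma exists_lyapunov_of_isHurwitz {ι : Type} [Fintype ι] [DecidableEq ι] {M : Matrix ι ι ℝ}
    (hM : IsHurwitz M) : ∃ S N : Matrix ι ι ℝ, Sᵀ = S ∧ IsUnit N ∧
      Mᵀ * S + S * M = -(Nᵀ * N) ∧
      ∀ {κ : Type} [Fintype κ] (X : Matrix ι κ ℝ), (Xᵀ * X).trace ≤ (Xᵀ * S * X).trace := by
  have hφ : (1 : ℂ) ∉ spectrum ℂ (M.map (fun r : ℝ => (r : ℂ))) := fun h => by
    have := hM 1 h; norm_num at this
  have hmap : ∀ X : Matrix ι ι ℝ, X.map (fun r : ℝ => (r : ℂ)) = Complex.ofRealHom.mapMatrix X :=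
    fun X => rfl
  have hNu : IsUnit (M - 1) := by
    rw [spectrum.notMem_iff, map_one, hmap] at hφ
    rw [Matrix.isUnit_iff_isUnit_det] at hφ ⊢
    have e : (1 : Matrix ι ι ℂ) - Complex.ofRealHom.mapMatrix M
        = Complex.ofRealHom.mapMatrix (1 - M) := by rw [map_sub, map_one]
    rw [e, ← RingHom.map_det] at hφ
    have h0 : (1 - M).det ≠ 0 := fun h => by simp [h] at hφ
    rw [← neg_sub, Matrix.det_neg]
    exact (((isUnit_one.neg).pow _).mul (IsUnit.mk0 _ h0))
  obtain ⟨b, h1, h2⟩ : ∃ b, (M - 1) * b = 1 ∧ b * (M - 1) = 1 := by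
    obtain ⟨u, hu⟩ := hNu
    exact ⟨↑u⁻¹, by rw [← hu]; simp, by rw [← hu]; simp⟩
  set A := (M + 1) * b with hA
  have hsum : Summable fun k => ‖A ^ k‖ ^ 2 := by
    have hc : ∀ z ∈ spectrum ℂ (Complex.ofRealHom.mapMatrix A), ‖z‖ < 1 := by
      intro z hz
      refine norm_lt_one_of_mem_spectrum_cayley (a := Complex.ofRealHom.mapMatrix M)
        (b := Complex.ofRealHom.mapMatrix b) hM ?_ ?_ ?_
      · rw [← map_one Complex.ofRealHom.mapMatrix, ← map_sub, ← map_mul, h1]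
      · rw [← map_one Complex.ofRealHom.mapMatrix, ← map_sub, ← map_mul, h2]
      · rwa [← map_one Complex.ofRealHom.mapMatrix, ← map_add, ← map_mul]
    have := summable_norm_pow_sq_of_spectrum hc
    refine this.congr fun k => ?_
    rw [← map_pow, RingHom.mapMatrix_apply,
      Matrix.frobenius_norm_map_eq (A ^ k) (⇑Complex.ofRealHom) (fun r => by simp)]
  have hS : Summable fun k => (A ^ k)ᵀ * A ^ k := by
    refine Summable.of_norm_bounded hsum fun k => ?_
    refine (norm_mul_le _ _).trans ?_
    rw [Matrix.frobenius_norm_transpose, sq]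
  set S := ∑' k, (A ^ k)ᵀ * A ^ k with hSdef
  have hST : Sᵀ = S := by
    rw [hSdef, Matrix.transpose_tsum]
    simp
  have hSA : S = 1 + Aᵀ * S * A := by
    conv_lhs => rw [hSdef, hS.tsum_eq_zero_add]
    congr 1
    · simp
    · rw [hSdef, ← hS.tsum_mul_left, ← (hS.mul_left _).tsum_mul_right]
      congr 1; ext1 k
      rw [pow_succ, Matrix.transpose_mul]
      simp only [Matrix.mul_assoc]
  have hAN : A * (M - 1) = M + 1 := by rw [hA, Matrix.mul_assoc, h2, Matrix.mul_one]
  clear_value A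
  -- rewriting `S = I + Aᵀ S A` with `A = (M + 1) (M - 1)⁻¹` yields the right-hand side
  -- `-(1/2) (M - 1)ᵀ (M - 1)`, whence the scaling
  obtain ⟨c, hc⟩ : ∃ c : ℝ, c * c = 1 / 2 := ⟨√(1 / 2), Real.mul_self_sqrt (by norm_num)⟩
  have hc0 : c ≠ 0 := by rintro rfl; norm_num at hc
  refine ⟨S, c • (M - 1), hST, ?_, ?_, ?_⟩
  · exact hNu.smul (Units.mk0 c hc0)
  · have h3 : (M - 1)ᵀ * S * (M - 1) = (M - 1)ᵀ * (M - 1) + (M + 1)ᵀ * S * (M + 1) := by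
      conv_lhs => rw [hSA]
      rw [← hAN, Matrix.transpose_mul]
      generalize (M - 1)ᵀ = B
      noncomm_ring
    rw [Matrix.transpose_smul, Matrix.smul_mul, Matrix.mul_smul, smul_smul, hc]
    have h4 : (M - 1)ᵀ * (M - 1) = (-2 : ℝ) • (Mᵀ * S + S * M) := by
      rw [eq_sub_of_add_eq h3.symm]
      simp only [Matrix.transpose_sub, Matrix.transpose_add, Matrix.transpose_one]
      rw [neg_smul, two_smul]
      noncomm_ring
    rw [h4, smul_smul]
    norm_num
    exact add_comm _ _
  · intro κ _ X
    have h5 : HasSum (fun k => (Xᵀ * ((A ^ k)ᵀ * A ^ k) * X).trace) (Xᵀ * S * X).trace := by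
      have hcont : Continuous fun B : Matrix ι ι ℝ => (Xᵀ * B * X).trace := by fun_prop
      exact hS.hasSum.map (AddMonoidHom.mk' (fun B : Matrix ι ι ℝ => (Xᵀ * B * X).trace)
        (fun B C => by simp [Matrix.mul_add, Matrix.add_mul])) hcont
    have h6 := le_hasSum h5 0 fun k _ => by
      have : Xᵀ * ((A ^ k)ᵀ * A ^ k) * X = (A ^ k * X)ᵀ * (A ^ k * X) := by
        rw [Matrix.transpose_mul]; simp only [Matrix.mul_assoc]
      rw [this]
      exact (Matrix.posSemidef_conjTranspose_mul_self (A ^ k * X)).trace_nonneg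
    simpa using h6

/-! ### Lyapunov's direct method for time-varying differential equations -/

section Stability

variable {E : Type} [NormedAddCommGroup E] [NormedSpace ℝ E]

lemma IsSolOn.mono {F : ℝ → E → E} {x : ℝ → E} {s s' : Set ℝ} (h : IsSolOn F x s)
    (hs : s' ⊆ s) : IsSolOn F x s' := fun t ht => (h t (hs ht)).mono hs

lemma IsSolOn.continuousOn {F : ℝ → E → E} {x : ℝ → E} {s : Set ℝ} (h : IsSolOn F x s) :
    ContinuousOn x s := fun t ht => (h t ht).continuousWithinAt

/-- Two solutions with the same initial state agree, for a vector field that is Lipschitz in the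
state. -/
lemma IsSolOn.eqOn_Icc {F : ℝ → E → E} {x y : ℝ → E} {a b : ℝ} {K : NNReal}
    (hF : ∀ t ∈ Set.Icc a b, LipschitzWith K (F t)) (hx : IsSolOn F x (Set.Icc a b))
    (hy : IsSolOn F y (Set.Icc a b)) (h : x a = y a) : Set.EqOn x y (Set.Icc a b) := by
  have right : ∀ z : ℝ → E, IsSolOn F z (Set.Icc a b) →
      ∀ t ∈ Set.Ico a b, HasDerivWithinAt z (F t (z t)) (Set.Ici t) t := fun z hz t ht =>
    (hz t (Set.Ico_subset_Icc_self ht)).mono_of_mem_nhdsWithin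
      (Filter.mem_of_superset (Icc_mem_nhdsGE ht.2) (Set.Icc_subset_Icc_left ht.1))
  exact ODE_solution_unique_of_mem_Icc_right (s := fun _ => Set.univ)
    (fun t ht => (hF t (Set.Ico_subset_Icc_self ht)).lipschitzOnWith) hx.continuousOn
    (right x hx) (fun _ _ => trivial) hy.continuousOn (right y hy) (fun _ _ => trivial) h

/-- A vector field that is Lipschitz in the state and bounded, on every compact time interval, has
a solution for all future times. -/
lemma exists_isSolOn_Ici [CompleteSpace E] {F : ℝ → E → E} (hc : ∀ x, Continuous fun t => F t x)
    (hL : ∀ a b : ℝ, ∃ K : NNReal, ∀ t ∈ Set.Icc a b, LipschitzWith K (F t))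
    (hB : ∀ a b : ℝ, ∃ L : NNReal, ∀ t ∈ Set.Icc a b, ∀ x, ‖F t x‖ ≤ L) (t₀ : ℝ) (x₀ : E) :
    ∃ x : ℝ → E, x t₀ = x₀ ∧ IsSolOn F x (Set.Ici t₀) := by
  have hex : ∀ N : ℕ, ∃ y : ℝ → E, y t₀ = x₀ ∧ IsSolOn F y (Set.Icc t₀ (t₀ + N)) := by
    intro N
    have hN : t₀ ≤ t₀ + N := by simp
    obtain ⟨K, hK⟩ := hL t₀ (t₀ + N)
    obtain ⟨L, hL⟩ := hB t₀ (t₀ + N)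
    -- the field is bounded on the whole space, so the ball may be as large as the length requires
    have hP : IsPicardLindelof F (⟨t₀, le_rfl, hN⟩ : Set.Icc t₀ (t₀ + N)) x₀ (L * N) 0 L K :=
      { lipschitzOnWith := fun t ht => (hK t ht).lipschitzOnWith
        continuousOn := fun x _ => (hc x).continuousOn
        norm_le := fun t ht x _ => hL t ht x
        mul_max_le := by simp }
    exact hP.exists_eq_forall_mem_Icc_hasDerivWithinAt₀
  choose y hy0 hy using hex
  have hle : ∀ N M : ℕ, N ≤ M → Set.EqOn (y N) (y M) (Set.Icc t₀ (t₀ + N)) := by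
    intro N M h
    obtain ⟨K, hK⟩ := hL t₀ (t₀ + N)
    have h' : (N : ℝ) ≤ M := by exact_mod_cast h
    exact (hy N).eqOn_Icc hK ((hy M).mono (Set.Icc_subset_Icc_right (by linarith)))
      ((hy0 N).trans (hy0 M).symm)
  set x : ℝ → E := fun t => y ⌈t - t₀⌉₊ t with hx
  have hxy : ∀ N : ℕ, Set.EqOn x (y N) (Set.Icc t₀ (t₀ + N)) := by
    intro N t ht
    refine hle _ _ (Nat.ceil_le.2 (by linarith [ht.2])) ⟨ht.1, ?_⟩
    linarith [Nat.le_ceil (t - t₀)]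
  refine ⟨x, ?_, fun t ht => ?_⟩
  · simp [hx, hy0]
  · have ht' : t₀ ≤ t := ht
    obtain ⟨N, hN⟩ := exists_nat_gt (t - t₀)
    have hmem : t ∈ Set.Icc t₀ (t₀ + N) := ⟨ht', by linarith⟩
    have h1 := (hy N t hmem).congr_of_mem (fun s hs => hxy N hs) hmem
    rw [← hxy N hmem] at h1
    refine h1.mono_of_mem_nhdsWithin ?_
    exact mem_nhdsWithin.2 ⟨Set.Iio (t₀ + N), isOpen_Iio, by simp; linarith,
      fun s hs => ⟨hs.2, hs.1.le⟩⟩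

/-- Decay of the solutions in a sublevel set of a Lyapunov function `v`, whose derivative along a
curve with velocity `x'` at the state `x` is `dv t x x'`. -/
lemma norm_le_of_lyapunov {F : ℝ → E → E} {v : ℝ → E → ℝ} {dv : ℝ → E → E → ℝ}
    {c k l r : ℝ} (hc : 0 < c) (hk : 0 < k) (hl : 0 < l)
    (hv : ∀ (x : ℝ → E) (x' : E) (s : Set ℝ) (t : ℝ), HasDerivWithinAt x x' s t →
      HasDerivWithinAt (fun τ => v τ (x τ)) (dv t (x t) x') s t)
    (hlow : ∀ t x, c * ‖x‖ ^ 2 ≤ v t x) (hup : ∀ t x, v t x ≤ c * k ^ 2 * ‖x‖ ^ 2)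
    (hdec : ∀ t x, ‖x‖ ≤ r → dv t x (F t x) ≤ -(2 * l) * v t x)
    {t₀ T : ℝ} {x : ℝ → E} (hx : IsSolOn F x (Set.Icc t₀ T)) (hr : k * ‖x t₀‖ < r) :
    ∀ t ∈ Set.Icc t₀ T, ‖x t‖ ≤ k * ‖x t₀‖ * Real.exp (-l * (t - t₀)) ∧ ‖x t‖ < r := by
  have key : ∀ τ ∈ Set.Icc t₀ T, (∀ s ∈ Set.Icc t₀ τ, ‖x s‖ ≤ r) →
      ‖x τ‖ ≤ k * ‖x t₀‖ * Real.exp (-l * (τ - t₀)) := by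
    intro τ hτ hs
    set φ : ℝ → ℝ := fun s => v s (x s) * Real.exp (2 * l * (s - t₀)) with hφ
    have hsub : Set.Icc t₀ τ ⊆ Set.Icc t₀ T := Set.Icc_subset_Icc_right hτ.2
    have hd : ∀ s ∈ Set.Icc t₀ τ, HasDerivWithinAt φ
        ((dv s (x s) (F s (x s)) + 2 * l * v s (x s)) * Real.exp (2 * l * (s - t₀)))
        (Set.Icc t₀ τ) s := by
      intro s hs
      have h1 := hv x _ _ s ((hx.mono hsub) s hs)
      have h2 : HasDerivAt (fun s => Real.exp (2 * l * (s - t₀)))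
          (Real.exp (2 * l * (s - t₀)) * (2 * l)) s := by
        have := (((hasDerivAt_id s).sub_const t₀).const_mul (2 * l)).exp
        simpa using this
      refine (h1.mul h2.hasDerivWithinAt).congr_deriv ?_
      ring
    have hanti : AntitoneOn φ (Set.Icc t₀ τ) := by
      refine antitoneOn_of_hasDerivWithinAt_nonpos (convex_Icc _ _)
        (fun s hs => (hd s hs).continuousWithinAt)
        (fun s hs => (hd s (interior_subset hs)).mono interior_subset) fun s hs' => ?_
      have h1 := hdec s (x s) (hs s (interior_subset hs'))
      refine mul_nonpos_of_nonpos_of_nonneg (by linarith) (Real.exp_pos _).le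
    have h3 := hanti (Set.left_mem_Icc.2 hτ.1) (Set.right_mem_Icc.2 hτ.1) hτ.1
    simp only [hφ, sub_self, mul_zero, Real.exp_zero, mul_one] at h3
    have h4 : ‖x τ‖ ^ 2 ≤ (k * ‖x t₀‖ * Real.exp (-l * (τ - t₀))) ^ 2 := by
      have e1 : Real.exp (2 * l * (τ - t₀)) * Real.exp (-l * (τ - t₀)) ^ 2 = 1 := by
        rw [sq, ← Real.exp_add, ← Real.exp_add, ← Real.exp_zero]
        congr 1; ring
      have h5 := (h3.trans (hup t₀ (x t₀)))
      have h6 := mul_le_mul_of_nonneg_right h5 (sq_nonneg (Real.exp (-l * (τ - t₀))))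
      rw [mul_assoc, e1, mul_one] at h6
      have h7 := (hlow τ (x τ)).trans h6
      refine le_of_mul_le_mul_left (h7.trans_eq ?_) hc
      ring
    exact (sq_le_sq₀ (norm_nonneg _) (by positivity)).1 h4
  have hexp : ∀ τ ∈ Set.Icc t₀ T, k * ‖x t₀‖ * Real.exp (-l * (τ - t₀)) ≤ k * ‖x t₀‖ := by
    intro τ hτ
    refine mul_le_of_le_one_right (by positivity) (Real.exp_le_one_iff.2 ?_)
    nlinarith [hτ.1]
  have hlt : ∀ t ∈ Set.Icc t₀ T, ‖x t‖ < r := by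
    by_contra! hcon
    -- the first time at which the solution reaches the sphere of radius `r`
    set Z := Set.Icc t₀ T ∩ {t | r ≤ ‖x t‖} with hZ
    have hZc : IsClosed Z :=
      (hx.continuousOn.norm).preimage_isClosed_of_isClosed isClosed_Icc isClosed_Ici
    have hZne : Z.Nonempty := let ⟨t, h1, h2⟩ := hcon; ⟨t, h1, h2⟩
    have hZb : BddBelow Z := ⟨t₀, fun t ht => ht.1.1⟩
    have hmem := hZc.csInf_mem hZne hZb
    set τ := sInf Z
    have hbefore : ∀ s ∈ Set.Ico t₀ τ, ‖x s‖ < r := by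
      intro s hs
      by_contra! h
      exact absurd (csInf_le hZb ⟨⟨hs.1, hs.2.le.trans hmem.1.2⟩, h⟩) (not_le.2 hs.2)
    rcases hmem.1.1.eq_or_lt with h0 | h0
    · have h1 := key τ hmem.1 fun s hs => ?_
      · exact absurd (h1.trans (hexp τ hmem.1)) (not_le.2 (hr.trans_le hmem.2))
      · have hs0 : s = t₀ := le_antisymm (h0 ▸ hs.2) hs.1
        have h2 := (hlow t₀ (x t₀)).trans (hup t₀ (x t₀))
        have h3 : ‖x t₀‖ ^ 2 ≤ (k * ‖x t₀‖) ^ 2 := le_of_mul_le_mul_left (by linarith) hc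
        rw [hs0]
        exact ((sq_le_sq₀ (norm_nonneg _) (by positivity)).1 h3).trans hr.le
    · have hcl : τ ∈ closure (Set.Ico t₀ τ) := by
        rw [closure_Ico h0.ne]; exact Set.right_mem_Icc.2 h0.le
      have hle : ‖x τ‖ ≤ r := by
        have hcw : ContinuousWithinAt (fun s => ‖x s‖) (Set.Ico t₀ τ) τ :=
          ((hx.continuousOn.norm) τ hmem.1).mono
            (Set.Ico_subset_Icc_self.trans (Set.Icc_subset_Icc_right hmem.1.2))
        exact hcw.closure_le hcl continuousWithinAt_const fun s hs => (hbefore s hs).le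
      have h1 := key τ hmem.1 fun s hs => by
        rcases hs.2.eq_or_lt with h | h
        · rw [h]; exact hle
        · exact (hbefore s ⟨hs.1, h⟩).le
      exact absurd (h1.trans (hexp τ hmem.1)) (not_le.2 (hr.trans_le hmem.2))
  exact fun t ht => ⟨key t ht fun s hs => (hlt s ⟨hs.1, hs.2.trans ht.2⟩).le, hlt t ht⟩

/-- A Lipschitz map with bounded range that is the identity on a given ball. -/
lemma exists_lipschitzWith_cutoff [FiniteDimensional ℝ E] {r : ℝ} (hr : 0 < r) :
    ∃ (ρ : E → E) (K : NNReal) (R : ℝ), LipschitzWith K ρ ∧ (∀ x, ‖ρ x‖ ≤ R) ∧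
      ∀ x, ‖x‖ ≤ r → ρ x = x := by
  let χ : ContDiffBump (0 : E) := ⟨r, r + 1, hr, by linarith⟩
  have hρ : ContDiff ℝ 1 fun x : E => χ x • x := χ.contDiff.smul contDiff_id
  have hcs : HasCompactSupport fun x : E => χ x • x := χ.hasCompactSupport.smul_right
  obtain ⟨K, hK⟩ := hρ.lipschitzWith_of_hasCompactSupport (𝕂 := ℝ) hcs one_ne_zero
  obtain ⟨R, hR⟩ := hcs.exists_bound_of_continuous hρ.continuous
  refine ⟨_, K, R, hK, hR, fun x hx => ?_⟩
  have : χ x = 1 := χ.one_of_mem_closedBall (by simpa [χ] using hx)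
  simp [this]

/-- Lyapunov's direct method. Existence for all future times holds because a solution of the field
truncated outside the ball of radius `r` never leaves that ball. -/
lemma decaysFrom_of_lyapunov [FiniteDimensional ℝ E] {F : ℝ → E → E} {v : ℝ → E → ℝ}
    {dv : ℝ → E → E → ℝ} {c k l r : ℝ} (hc : 0 < c) (hk : 0 < k) (hl : 0 < l)
    (hFc : ∀ x, Continuous fun t => F t x) (hF0 : ∀ t, F t 0 = 0)
    (hFL : ∀ a b R : ℝ, ∃ K : NNReal, ∀ t ∈ Set.Icc a b,
      LipschitzOnWith K (F t) (Metric.closedBall 0 R))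
    (hv : ∀ (x : ℝ → E) (x' : E) (s : Set ℝ) (t : ℝ), HasDerivWithinAt x x' s t →
      HasDerivWithinAt (fun τ => v τ (x τ)) (dv t (x t) x') s t)
    (hlow : ∀ t x, c * ‖x‖ ^ 2 ≤ v t x) (hup : ∀ t x, v t x ≤ c * k ^ 2 * ‖x‖ ^ 2)
    (hdec : ∀ t x, ‖x‖ ≤ r → dv t x (F t x) ≤ -(2 * l) * v t x)
    (t₀ : ℝ) {x₀ : E} (hr : k * ‖x₀‖ < r) : DecaysFrom F k l t₀ x₀ := by
  refine ⟨?_, fun T x hx0 hx t ht => ?_⟩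
  · have hr0 : 0 < r := lt_of_le_of_lt (by positivity) hr
    obtain ⟨ρ, Kρ, R, hρL, hρR, hρ⟩ := exists_lipschitzWith_cutoff (E := E) hr0
    have hmem : ∀ x, ρ x ∈ Metric.closedBall (0 : E) R := fun x => by simpa using hρR x
    have hR : 0 ≤ R := (norm_nonneg _).trans (hρR 0)
    have : CompleteSpace E := FiniteDimensional.complete ℝ E
    obtain ⟨x, hx0, hx⟩ := exists_isSolOn_Ici (F := fun t x => F t (ρ x)) (fun x => hFc (ρ x))
      (fun a b => by
        obtain ⟨K, hK⟩ := hFL a b R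
        exact ⟨K * Kρ, fun t ht => LipschitzWith.of_dist_le_mul fun x y => by
          refine ((hK t ht).dist_le_mul _ (hmem x) _ (hmem y)).trans ?_
          rw [NNReal.coe_mul, mul_assoc]
          exact mul_le_mul_of_nonneg_left (hρL.dist_le_mul x y) K.2⟩)
      (fun a b => by
        obtain ⟨K, hK⟩ := hFL a b R
        refine ⟨K * ⟨R, hR⟩, fun t ht x => ?_⟩
        have := (hK t ht).dist_le_mul _ (hmem x) 0 (by simpa using hR)
        rw [hF0, dist_zero_right, dist_zero_right] at this
        exact this.trans (mul_le_mul_of_nonneg_left (hρR x) K.2)) t₀ x₀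
    refine ⟨x, hx0, fun t ht => ?_⟩
    have hdec' : ∀ t x, ‖x‖ ≤ r → dv t x (F t (ρ x)) ≤ -(2 * l) * v t x := fun t x h => by
      rw [hρ x h]; exact hdec t x h
    have hb := norm_le_of_lyapunov hc hk hl hv hlow hup hdec'
      (hx.mono (Set.Icc_subset_Ici_self : Set.Icc t₀ t ⊆ _)) (by rwa [hx0]) t
      (Set.right_mem_Icc.2 ht)
    have := hx t ht
    simp only [hρ _ hb.2.le] at this
    exact this
  · rw [← hx0]
    exact (norm_le_of_lyapunov hc hk hl hv hlow hup hdec hx (by rwa [hx0]) t ht).1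

end Stability

/-! ### Uniform first-order estimates -/

section Uniform

variable {C E E' : Type} [NormedAddCommGroup C] [NormedSpace ℝ C] [FiniteDimensional ℝ C]
  [NormedAddCommGroup E] [NormedSpace ℝ E] [FiniteDimensional ℝ E]
  [NormedAddCommGroup E'] [NormedSpace ℝ E']

lemma exists_lipschitzOnWith_of_contDiff {Φ : C × E → E'} (hΦ : ContDiff ℝ 1 Φ) {c : ℝ → C}
    (hc : Continuous c) (a b R : ℝ) : ∃ K : NNReal, ∀ t ∈ Set.Icc a b,
      LipschitzOnWith K (fun x => Φ (c t, x)) (Metric.closedBall 0 R) := by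
  obtain ⟨Q, hQ⟩ := (isCompact_Icc (a := a) (b := b)).exists_bound_of_continuousOn hc.continuousOn
  have : ProperSpace (C × E) := FiniteDimensional.proper ℝ _
  obtain ⟨K, hK⟩ := (hΦ.contDiffOn (s := Metric.closedBall 0 (max Q R))).exists_lipschitzOnWith
    one_ne_zero (convex_closedBall _ _) (isCompact_closedBall _ _)
  refine ⟨K, fun t ht => LipschitzOnWith.of_dist_le_mul fun x hx y hy => ?_⟩
  have hmem : ∀ x ∈ Metric.closedBall (0 : E) R,
      (c t, x) ∈ Metric.closedBall (0 : C × E) (max Q R) := fun x hx => by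
    rw [mem_closedBall_zero_iff] at hx ⊢
    exact max_le_max (hQ t ht) hx
  refine (hK.dist_le_mul _ (hmem x hx) _ (hmem y hy)).trans_eq ?_
  rw [Prod.dist_eq, dist_self, max_eq_right dist_nonneg]

/-- The first-order Taylor estimate at `0` of a `C¹` function of a parameter and a state is uniform
over bounded sets of parameters. -/
lemma exists_uniform_linearization {Φ : C × E → E'} (hΦ : ContDiff ℝ 1 Φ) {S : Set C}
    (hS : Bornology.IsBounded S) {ε : ℝ} (hε : 0 < ε) : ∃ δ > 0, ∀ c ∈ S, ∀ x : E, ‖x‖ ≤ δ →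
      ‖Φ (c, x) - Φ (c, 0) - fderiv ℝ (fun y => Φ (c, y)) 0 x‖ ≤ ε * ‖x‖ := by
  have : ProperSpace (C × E) := FiniteDimensional.proper ℝ _
  obtain ⟨R, hR⟩ := hS.exists_norm_le
  have hcont := hΦ.continuous_fderiv one_ne_zero
  have huc := (isCompact_closedBall (0 : C × E) (max R 1)).uniformContinuousOn_of_continuous
    hcont.continuousOn
  obtain ⟨δ, hδ, h⟩ := Metric.uniformContinuousOn_iff.1 huc ε hε
  refine ⟨min (δ / 2) 1, by positivity, fun c hc x hx => ?_⟩
  have hd : ∀ y, HasFDerivAt (fun y => Φ (c, y))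
      ((fderiv ℝ Φ (c, y)).comp (ContinuousLinearMap.inr ℝ C E)) y := fun y =>
    ((hΦ.differentiable one_ne_zero _).hasFDerivAt).comp y (hasFDerivAt_prodMk_right c y)
  have hmem : ∀ y : E, ‖y‖ ≤ 1 → (c, y) ∈ Metric.closedBall (0 : C × E) (max R 1) := fun y hy => by
    rw [mem_closedBall_zero_iff]
    exact max_le_max (hR c hc) hy
  have h1 := Convex.norm_image_sub_le_of_norm_hasFDerivWithin_le'
    (hs := convex_closedBall (0 : E) (min (δ / 2) 1)) (f := fun y => Φ (c, y))
    (C := ε) (φ := fderiv ℝ (fun y => Φ (c, y)) 0)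
    (fun y _ => (hd y).hasFDerivWithinAt) (fun y hy => ?_) (x := 0) (y := x)
    (by simp; positivity) (by simpa using hx)
  · simpa using h1
  · rw [mem_closedBall_zero_iff] at hy
    rw [(hd 0).fderiv, ← ContinuousLinearMap.sub_comp]
    refine (ContinuousLinearMap.opNorm_comp_le _ _).trans ?_
    have h2 := h (c, y) (hmem y (hy.trans (min_le_right _ _))) (c, 0) (hmem 0 (by simp)) (by
      rw [Prod.dist_eq, dist_self, max_eq_right dist_nonneg, dist_zero_right]
      have := hy.trans (min_le_left _ _)
      linarith)
    rw [dist_eq_norm] at h2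
    have h3 := ContinuousLinearMap.norm_inr_le_one ℝ C E
    nlinarith [norm_nonneg (fderiv ℝ Φ (c, y) - fderiv ℝ Φ (c, 0))]

lemma exists_pos_mul_norm_sq_le (B : E →L[ℝ] E →L[ℝ] ℝ) (hB : ∀ x, x ≠ 0 → 0 < B x x) :
    ∃ c > 0, ∀ x, c * ‖x‖ ^ 2 ≤ B x x := by
  rcases subsingleton_or_nontrivial E with h | h
  · exact ⟨1, one_pos, fun x => by rw [Subsingleton.elim x 0]; simp⟩
  have : ProperSpace E := FiniteDimensional.proper ℝ _
  obtain ⟨z, hz, hmin⟩ := (isCompact_sphere (0 : E) 1).exists_isMinOn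
    (NormedSpace.sphere_nonempty.2 zero_le_one) (f := fun x => B x x)
    (by fun_prop)
  refine ⟨B z z, hB z (ne_zero_of_mem_unit_sphere ⟨z, hz⟩), fun x => ?_⟩
  rcases eq_or_ne x 0 with rfl | hx
  · simp
  have h1 : B z z ≤ B (‖x‖⁻¹ • x) (‖x‖⁻¹ • x) := hmin (by simp [norm_smul, hx])
  have hx' : 0 < ‖x‖ := norm_pos_iff.2 hx
  simp only [map_smul, smul_apply, smul_eq_mul] at h1
  calc B z z * ‖x‖ ^ 2 ≤ (‖x‖⁻¹ * (‖x‖⁻¹ * B x x)) * ‖x‖ ^ 2 := by gcongr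
    _ = B x x := by field_simp

omit [FiniteDimensional ℝ E] in
lemma exists_bilin_le (B : E →L[ℝ] E →L[ℝ] ℝ) : ∃ β > 0, ∀ x y, B x y ≤ β * ‖x‖ * ‖y‖ := by
  refine ⟨‖B‖ + 1, by positivity, fun x y => ?_⟩
  refine (le_abs_self _).trans ((B.le_opNorm₂ x y).trans ?_)
  gcongr
  linarith

omit [FiniteDimensional ℝ E] in
lemma hasDerivWithinAt_quadratic {B : E →L[ℝ] E →L[ℝ] ℝ} (hB : ∀ x y, B x y = B y x) {y : ℝ → E}
    {y' : E} {s : Set ℝ} {t : ℝ} (hy : HasDerivWithinAt y y' s t) :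
    HasDerivWithinAt (fun τ => B (y τ) (y τ)) (2 * B (y t) y') s t := by
  refine ((B.hasFDerivAt.comp_hasDerivWithinAt t hy).clm_apply hy).congr_deriv ?_
  rw [hB y']
  simp only [Function.comp_apply]
  ring

omit [NormedSpace ℝ E] [FiniteDimensional ℝ E] in
lemma isBounded_image_of_continuous {Ψ : C → E} (hΨ : Continuous Ψ) {p : ℝ → C} (R : ℝ)
    (hp : ∀ t, ‖p t‖ ≤ R) : Bornology.IsBounded (Set.range fun t => Ψ (p t)) := by
  have : ProperSpace C := FiniteDimensional.proper ℝ _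
  refine ((isCompact_closedBall (0 : C) R).image hΨ).isBounded.subset ?_
  rintro _ ⟨t, rfl⟩
  exact ⟨p t, mem_closedBall_zero_iff.2 (hp t), rfl⟩

/-- A linear time-varying system with a quadratic Lyapunov function is exponentially stable. -/
lemma globallyExpStable_of_lyapunov {F : ℝ → E → E} {A : ℝ → E →L[ℝ] E} (hA : Continuous A)
    (hF : ∀ t x, A t x = F t x) {v : ℝ → E → ℝ} {dv : ℝ → E → E → ℝ} {c k l : ℝ} (hc : 0 < c)
    (hk : 0 < k) (hl : 0 < l)
    (hv : ∀ (x : ℝ → E) (x' : E) (s : Set ℝ) (t : ℝ), HasDerivWithinAt x x' s t →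
      HasDerivWithinAt (fun τ => v τ (x τ)) (dv t (x t) x') s t)
    (hlow : ∀ t x, c * ‖x‖ ^ 2 ≤ v t x) (hup : ∀ t x, v t x ≤ c * k ^ 2 * ‖x‖ ^ 2)
    (hdec : ∀ t x, dv t x (F t x) ≤ -(2 * l) * v t x) : GloballyExpStable F := by
  obtain rfl : (fun t x => A t x) = F := funext₂ hF
  have hΦ : ContDiff ℝ 1 fun q : (E →L[ℝ] E) × E => q.1 q.2 :=
    contDiff_fst.clm_apply contDiff_snd
  refine ⟨k, hk, l, hl, fun t₀ x₀ => ?_⟩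
  exact decaysFrom_of_lyapunov (F := fun t x => A t x) (r := k * ‖x₀‖ + 1) hc hk hl
    (fun x => hA.clm_apply continuous_const) (fun t => map_zero _)
    (exists_lipschitzOnWith_of_contDiff hΦ hA) hv hlow hup (fun t x _ => hdec t x) t₀ (lt_add_one _)

/-- Stability by linearization: a system `ẋ = Φ(c(t), x)` with a bounded parameter `c` is
exponentially stable if its linearization, in the state `J x`, has a quadratic Lyapunov function
that tolerates small perturbations of the velocity. -/
lemma expStable_of_lyapunov_linearization {Φ : C × E → E}
    (hΦ : ContDiff ℝ 1 Φ) {p : ℝ → C} (hp : Continuous p) (hb : Bornology.IsBounded (Set.range p))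
    {F : ℝ → E → E} (hF : ∀ t x, Φ (p t, x) = F t x) (hF0 : ∀ t, Φ (p t, 0) = 0)
    {J : E →L[ℝ] E'} {a : ℝ} (ha : 0 < a) (hJ : ∀ x, ‖x‖ ≤ a * ‖J x‖) {S : ℝ → E' → E'}
    (hS : ∀ t x, J (fderiv ℝ (fun y => Φ (p t, y)) 0 x) = S t (J x))
    {v : ℝ → E' → ℝ} {dv : ℝ → E' → E' → ℝ} {c k l ε : ℝ} (hc : 0 < c)
    (hk : 0 < k) (hl : 0 < l) (hε : 0 < ε)
    (hv : ∀ (x : ℝ → E') (x' : E') (s : Set ℝ) (t : ℝ), HasDerivWithinAt x x' s t →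
      HasDerivWithinAt (fun τ => v τ (x τ)) (dv t (x t) x') s t)
    (hlow : ∀ t x, c * ‖x‖ ^ 2 ≤ v t x) (hup : ∀ t x, v t x ≤ c * k ^ 2 * ‖x‖ ^ 2)
    (hdec : ∀ t x R, ‖R‖ ≤ ε * ‖x‖ → dv t x (S t x + R) ≤ -(2 * l) * v t x) : ExpStable F := by
  obtain rfl : (fun t x => Φ (p t, x)) = F := funext₂ hF
  set j := ‖J‖ + 1 with hj
  have hj0 : 0 < j := by positivity
  have hJle : ∀ x, ‖J x‖ ≤ j * ‖x‖ := fun x => (J.le_opNorm x).trans (by gcongr; linarith)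
  obtain ⟨δ, hδ, hlin⟩ := exists_uniform_linearization hΦ hb (ε := ε / (a * j)) (by positivity)
  refine ⟨δ / (a * k * j), by positivity, a * k * j, by positivity, l, hl, fun t₀ x₀ hx₀ => ?_⟩
  refine decaysFrom_of_lyapunov (F := fun t x => Φ (p t, x)) (v := fun t x => v t (J x))
    (dv := fun t x x' => dv t (J x) (J x'))
    (c := c / a ^ 2) (r := δ) (by positivity) (by positivity) hl
    (fun x => hΦ.continuous.comp (hp.prodMk continuous_const)) hF0
    (exists_lipschitzOnWith_of_contDiff hΦ hp) (fun x x' s t hx => ?_) (fun t x => ?_)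
    (fun t x => ?_) (fun t x hx => ?_) t₀ ?_
  · exact hv _ _ s t (J.hasFDerivAt.comp_hasDerivWithinAt t hx)
  · refine le_trans ?_ (hlow t (J x))
    calc c / a ^ 2 * ‖x‖ ^ 2 ≤ c / a ^ 2 * (a * ‖J x‖) ^ 2 := by gcongr; exact hJ x
      _ = c * ‖J x‖ ^ 2 := by field_simp
  · refine (hup t (J x)).trans ?_
    calc c * k ^ 2 * ‖J x‖ ^ 2 ≤ c * k ^ 2 * (j * ‖x‖) ^ 2 := by gcongr; exact hJle x
      _ = c / a ^ 2 * (a * k * j) ^ 2 * ‖x‖ ^ 2 := by field_simp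
  · have h1 := hlin _ ⟨t, rfl⟩ x hx
    rw [hF0, sub_zero] at h1
    have h2 := hdec t (J x) (J (Φ (p t, x)) - S t (J x)) (by
      rw [← hS, ← map_sub]
      calc _ ≤ j * (ε / (a * j) * (a * ‖J x‖)) := by
            refine (hJle _).trans ?_
            gcongr
            refine h1.trans ?_
            gcongr
            exact hJ x
        _ = ε * ‖J x‖ := by field_simp)
    rwa [add_sub_cancel] at h2
  · rw [lt_div_iff₀ (by positivity)] at hx₀
    linarith

end Uniform

/-! ### The gradient and the Hessian of `V` -/

section Hessian

-- The entrywise topology on matrices agrees with that of the Frobenius norm only after unfolding;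
-- removing its instances makes every topological notion below refer to the norm.
attribute [-instance] instTopologicalSpaceMatrix Matrix.instUniformSpace

variable {n : ℕ} {G : Subgroup (GL (Fin n) ℝ)}

lemma frob_self (A : Mat n) : frob n A A = ‖A‖ ^ 2 := by
  rw [frob_apply, Matrix.frobenius_norm_def, ← Real.sqrt_eq_rpow, Real.sq_sqrt (by positivity),
    Matrix.trace, Finset.sum_comm]
  simp [Matrix.mul_apply, sq]

lemma frob_grad (V : Mat n → ℝ) (x h : Mat n) : frob n (grad V x) h = fderiv ℝ V x h := by
  conv_rhs => rw [Matrix.matrix_eq_sum_single h]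
  simp only [map_sum]
  rw [Finset.sum_comm, frob_apply, Matrix.trace]
  refine Finset.sum_congr rfl fun j _ => ?_
  rw [Matrix.diag_apply, Matrix.mul_apply]
  refine Finset.sum_congr rfl fun i _ => ?_
  have : Matrix.single i j (h i j) = h i j • Matrix.single i j (1 : ℝ) := by
    rw [Matrix.smul_single, smul_eq_mul, mul_one]
  rw [this, map_smul, Matrix.transpose_apply, smul_eq_mul, mul_comm]
  rfl

lemma eq_of_frob_eq {A B : Mat n} (h : ∀ C, frob n A C = frob n B C) : A = B := by
  rw [← sub_eq_zero]
  refine frob_self_eq_zero ?_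
  rw [map_sub (frob n), LinearMap.sub_apply, h, sub_self]

lemma contDiff_grad {V : Mat n → ℝ} (hV : ContDiff ℝ 2 V) : ContDiff ℝ 1 (grad V) := by
  have h : grad V = fun x => ∑ i, ∑ j, fderiv ℝ V x (Matrix.single i j 1) •
      Matrix.single i j (1 : ℝ) := by
    ext1 x
    rw [Matrix.matrix_eq_sum_single (grad V x)]
    refine Finset.sum_congr rfl fun i _ => Finset.sum_congr rfl fun j _ => ?_
    rw [Matrix.smul_single, smul_eq_mul, mul_one]
    rfl
  rw [h]
  have h1 : ContDiff ℝ 1 (fderiv ℝ V) := hV.fderiv_right (by norm_num)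
  exact ContDiff.sum fun i _ => ContDiff.sum fun j _ =>
    (h1.clm_apply contDiff_const).smul contDiff_const

lemma frob_hess {V : Mat n → ℝ} (hV : ContDiff ℝ 2 V) (x y w : Mat n) :
    frob n (hess V x y) w = fderiv ℝ (fderiv ℝ V) x y w := by
  have h1 : HasFDerivAt (grad V) (hess V x) x :=
    ((contDiff_grad hV).differentiable one_ne_zero x).hasFDerivAt
  have h2 := (LinearMap.toContinuousLinearMap ((frob n).flip w)).hasFDerivAt.comp x h1
  have h3 : HasFDerivAt (fderiv ℝ V) (fderiv ℝ (fderiv ℝ V) x) x :=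
    ((hV.fderiv_right (m := 1) (by norm_num)).differentiable one_ne_zero x).hasFDerivAt
  have h4 := (ContinuousLinearMap.apply ℝ ℝ w).hasFDerivAt.comp x h3
  have h5 : (LinearMap.toContinuousLinearMap ((frob n).flip w)) ∘ grad V
      = (ContinuousLinearMap.apply ℝ ℝ w) ∘ fderiv ℝ V := by
    ext1 z; exact frob_grad V z w
  rw [h5] at h2
  exact DFunLike.congr_fun (h2.unique h4) y

lemma frob_hess_comm {V : Mat n → ℝ} (hV : ContDiff ℝ 2 V) (x y w : Mat n) :
    frob n (hess V x y) w = frob n (hess V x w) y := by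
  rw [frob_hess hV, frob_hess hV]
  exact (hV.contDiffAt.isSymmSndFDerivAt (by simp)).eq y w

lemma IsTransversal.grad_mat {V : Mat n → ℝ} (hV : IsTransversal G V) (g : G) :
    grad V (mat g) = 0 := by
  refine eq_of_frob_eq fun C => ?_
  have h : IsLocalMin V (mat g) := Filter.Eventually.of_forall fun x => by
    rw [(hV.zero_iff _).2 ⟨g, rfl⟩]; exact hV.nonneg x
  have h' : fderiv ℝ V (mat g) = 0 := h.fderiv_eq_zero
  rw [frob_grad]
  exact (DFunLike.congr_fun h' C).trans (by simp)

lemma IsTransversal.grad_one {V : Mat n → ℝ} (hV : IsTransversal G V) : grad V 1 = 0 := by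
  have := hV.grad_mat 1
  simpa [mat] using this

/-- The gradient vanishes along `G`, hence the Hessian at the identity kills the Lie algebra. -/
lemma IsTransversal.hess_lieAlg {V : Mat n → ℝ} (hV : IsTransversal G V) {A : Mat n}
    (hA : A ∈ lieAlg G) : hess V 1 A = 0 := by
  obtain ⟨γ, -, hγG, hγ0, hγ'⟩ := hA
  have h1 : HasFDerivAt (grad V) (hess V 1) (γ 0) := by
    rw [hγ0]
    exact ((contDiff_grad hV.contDiff).differentiable one_ne_zero 1).hasFDerivAt
  have h2 := h1.comp_hasDerivAt (0 : ℝ) hγ'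
  have h3 : grad V ∘ γ = fun _ => 0 := by
    ext1 t
    obtain ⟨g, hg⟩ := hγG t
    rw [Function.comp_apply, ← hg, hV.grad_mat]
  rw [h3] at h2
  exact h2.unique (hasDerivAt_const _ _)

lemma frob_eq_zero_of_mem {A B : Mat n} (hA : A ∈ lieAlg G) (hB : B ∈ perp G) :
    frob n B A = 0 := by
  rw [frob_symm]
  exact LinearMap.BilinForm.mem_orthogonal_iff.1 hB A hA

lemma IsTransversal.hess_mem_perp {V : Mat n → ℝ} (hV : IsTransversal G V) (y : Mat n) :
    hess V 1 y ∈ perp G := by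
  refine LinearMap.BilinForm.mem_orthogonal_iff.2 fun A hA => ?_
  change frob n A _ = 0
  rw [frob_symm, frob_hess_comm hV.contDiff, hV.hess_lieAlg hA]
  simp

lemma prl_add_prp (A : Mat n) : (prl G A : Mat n) + prp G A = A :=
  Submodule.projection_add_projection_eq_self (isCompl_perp G) A

lemma prl_coe (A : lieAlg G) : prl G (A : Mat n) = A :=
  Submodule.projectionOnto_apply_left _ A

lemma prp_lieAlg (A : lieAlg G) : prp G (A : Mat n) = 0 :=
  Submodule.projectionOnto_apply_right _ A

lemma frob_prp {y : Mat n} (hy : y ∈ perp G) (A : Mat n) :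
    frob n y (prp G A : Mat n) = frob n y A := by
  conv_rhs => rw [← prl_add_prp (G := G) A, map_add, frob_eq_zero_of_mem (prl G A).2 hy, zero_add]

lemma IsTransversal.hess_prp {V : Mat n → ℝ} (hV : IsTransversal G V) (y : Mat n) :
    hess V 1 (prp G y : Mat n) = hess V 1 y := by
  conv_rhs => rw [← prl_add_prp (G := G) y, map_add, hV.hess_lieAlg (prl G y).2, zero_add]

/-- Right invariance of `V` in terms of its gradient. -/
lemma IsTransversal.grad_mul {V : Mat n → ℝ} (hV : IsTransversal G V) (x : Mat n) (g : G) :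
    grad V (x * mat g) = grad V x * (mat g⁻¹)ᵀ := by
  have hdiff := hV.contDiff.differentiable two_ne_zero
  have h1 : HasFDerivAt (fun y => V (y * mat g))
      ((fderiv ℝ V (x * mat g)).comp ((ContinuousLinearMap.mul ℝ (Mat n)).flip (mat g))) x :=
    (hdiff _).hasFDerivAt.comp x ((ContinuousLinearMap.mul ℝ (Mat n)).flip (mat g)).hasFDerivAt
  have h2 : (fun y => V (y * mat g)) = V := funext fun y => hV.invariant y g
  rw [h2] at h1
  refine eq_of_frob_eq fun C => ?_
  have h3 := DFunLike.congr_fun h1.fderiv (C * mat g⁻¹)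
  simp only [ContinuousLinearMap.comp_apply, ContinuousLinearMap.flip_apply,
    ContinuousLinearMap.mul_apply', Matrix.mul_assoc, mat_inv_mul, Matrix.mul_one] at h3
  rw [frob_grad, ← h3, ← frob_grad, frob_apply, frob_apply, Matrix.transpose_mul,
    Matrix.transpose_transpose, ← Matrix.mul_assoc, Matrix.trace_mul_comm, ← Matrix.mul_assoc]

end Hessian

/-! ### Derivatives along the reference trajectory -/

section Reference

attribute [-instance] instTopologicalSpaceMatrix Matrix.instUniformSpace

variable {n m : ℕ} {G : Subgroup (GL (Fin n) ℝ)}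

lemma gramInv_eq (g₀ : ℝ → G) (t : ℝ) :
    gramInv g₀ t = (mat (g₀ t)⁻¹)ᵀ * mat (g₀ t)⁻¹ := by
  refine Matrix.inv_eq_right_inv ?_
  rw [Matrix.mul_assoc, ← Matrix.mul_assoc (mat (g₀ t))ᵀ, ← Matrix.transpose_mul, mat_inv_mul,
    Matrix.transpose_one, Matrix.one_mul, mat_mul_inv]

lemma gramInvDot_eq (g₀ : ℝ → G) (ξ₀ : ℝ → lieAlg G) (t : ℝ) :
    gramInvDot g₀ ξ₀ t = -((mat (g₀ t)⁻¹)ᵀ * (ξ₀ t : Mat n) * mat (g₀ t)⁻¹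
      + (mat (g₀ t)⁻¹)ᵀ * (ξ₀ t : Mat n)ᵀ * mat (g₀ t)⁻¹) := by
  have h1 : mat (g₀ t)⁻¹ * mat (g₀ t) = 1 := mat_inv_mul _
  have h2 : (mat (g₀ t))ᵀ * (mat (g₀ t)⁻¹)ᵀ = 1 := by rw [← Matrix.transpose_mul, h1]; simp
  rw [gramInvDot, gramInv_eq]
  generalize mat (g₀ t)⁻¹ = N at h1 h2 ⊢
  generalize mat (g₀ t) = M at h1 h2 ⊢
  have h3 : ∀ X : Mat n, Nᵀ * N * (M * X * Mᵀ) * (Nᵀ * N) = Nᵀ * X * N := fun X => by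
    calc _ = Nᵀ * (N * M) * X * (Mᵀ * Nᵀ) * N := by simp only [Matrix.mul_assoc]
      _ = _ := by rw [h1, h2]; simp
  rw [mul_add, add_mul, h3, h3]

/-- The partial derivative in time of `W`, for a frozen state `η`. -/
noncomputable def WPartial (V : Mat n → ℝ) (α : ℝ) (g₀ : ℝ → G) (ξ₀ : ℝ → lieAlg G) (t : ℝ)
    (η : perp G) : lieAlg G :=
  -(α • prl G (hess V 1 (η : Mat n) * gramInvDot g₀ ξ₀ t))

lemma Wdot_eq (V : Mat n → ℝ) (α : ℝ) (g₀ : ℝ → G) (ξ₀ : ℝ → lieAlg G) (t : ℝ) (η : perp G) :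
    Wdot V α g₀ ξ₀ t η = W V α g₀ t (perpField V α g₀ t η) + WPartial V α g₀ ξ₀ t η := by
  rw [Wdot, W, WPartial, map_add (prl G), smul_add, neg_add]

lemma W_add (V : Mat n → ℝ) (α : ℝ) (g₀ : ℝ → G) (t : ℝ) (η η' : perp G) :
    W V α g₀ t (η + η') = W V α g₀ t η + W V α g₀ t η' := by
  simp only [W, Submodule.coe_add, map_add, add_mul, smul_add, neg_add]

lemma Ad_inv_Ad (g : G) (e : lieAlg G) : Ad g⁻¹ (Ad g e) = e := by
  ext1
  change mat g⁻¹ * (mat g * e * mat g⁻¹) * mat g⁻¹⁻¹ = (e : Mat n)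
  have h := mat_inv_mul g
  rw [inv_inv, Matrix.mul_assoc, Matrix.mul_assoc (mat g * (e : Mat n)), h, Matrix.mul_one,
    ← Matrix.mul_assoc, h, Matrix.one_mul]

lemma Ad_Ad_inv (g : G) (e : lieAlg G) : Ad g (Ad g⁻¹ e) = e := by
  simpa using Ad_inv_Ad g⁻¹ e

lemma Ad_eq_prl (g : G) (e : lieAlg G) : Ad g e = prl G (mat g * e * mat g⁻¹) :=
  (prl_coe (Ad g e)).symm

variable {g₀ : ℝ → G} {ξ₀ : ℝ → lieAlg G}
  (hg : ∀ t, HasDerivAt (fun s => mat (g₀ s)) (mat (g₀ t) * (ξ₀ t : Mat n)) t)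

include hg

lemma hasDerivAt_mat_inv (t : ℝ) :
    HasDerivAt (fun s => mat (g₀ s)⁻¹) (-((ξ₀ t : Mat n) * mat (g₀ t)⁻¹)) t := by
  have h1 := (hasFDerivAt_ringInverse (𝕜 := ℝ) ((g₀ t : GL (Fin n) ℝ) : (Mat n)ˣ)).comp_hasDerivAt t
    (hg t)
  have h2 : (Ring.inverse ∘ fun s => mat (g₀ s)) = fun s => mat (g₀ s)⁻¹ := by
    ext1 s
    exact Ring.inverse_unit ((g₀ s : GL (Fin n) ℝ) : (Mat n)ˣ)
  rw [h2] at h1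
  refine h1.congr_deriv ?_
  change -(mat (g₀ t)⁻¹ * (mat (g₀ t) * (ξ₀ t : Mat n)) * mat (g₀ t)⁻¹) = _
  have h := mat_inv_mul (g₀ t)
  rw [← Matrix.mul_assoc, h, Matrix.one_mul]

lemma hasDerivAt_gramInv (t : ℝ) :
    HasDerivAt (fun s => gramInv g₀ s) (gramInvDot g₀ ξ₀ t) t := by
  have h1 := hasDerivAt_mat_inv hg t
  have h2 : HasDerivAt (fun s => (mat (g₀ s)⁻¹)ᵀ) (-((ξ₀ t : Mat n) * mat (g₀ t)⁻¹))ᵀ t :=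
    (LinearMap.toContinuousLinearMap
      (Matrix.transposeLinearEquiv (Fin n) (Fin n) ℝ ℝ).toLinearMap).hasFDerivAt.comp_hasDerivAt
        t h1
  have h3 := h2.mul h1
  simp only [gramInv_eq]
  refine h3.congr_deriv ?_
  rw [gramInvDot_eq, Matrix.transpose_neg, Matrix.transpose_mul]
  noncomm_ring

lemma hasDerivWithinAt_W (V : Mat n → ℝ) (α : ℝ) {η : ℝ → perp G} {η' : perp G} {s : Set ℝ} {t : ℝ}
    (hη : HasDerivWithinAt η η' s t) :
    HasDerivWithinAt (fun τ => W V α g₀ τ (η τ))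
      (W V α g₀ t η' + WPartial V α g₀ ξ₀ t (η t)) s t := by
  let L : perp G →L[ℝ] Mat n := LinearMap.toContinuousLinearMap
    ((hess V 1 : Mat n →ₗ[ℝ] Mat n) ∘ₗ (perp G).subtype)
  have h1 : HasDerivWithinAt (fun τ => L (η τ)) (L η') s t :=
    L.hasFDerivAt.comp_hasDerivWithinAt t hη
  have h2 := h1.mul (hasDerivAt_gramInv hg t).hasDerivWithinAt
  have h3 := (LinearMap.toContinuousLinearMap (prl G)).hasFDerivAt.comp_hasDerivWithinAt t h2
  refine (h3.const_smul α).neg.congr_deriv ?_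
  rw [W, WPartial, ← neg_add, ← smul_add, ← map_add (prl G)]
  rfl

lemma hasDerivWithinAt_Ad {e : ℝ → lieAlg G} {e' : lieAlg G} {s : Set ℝ} {t : ℝ}
    (he : HasDerivWithinAt e e' s t) :
    HasDerivWithinAt (fun τ => Ad (g₀ τ) (e τ)) (Ad (g₀ t) (e' - bracket (e t) (ξ₀ t))) s t := by
  have h1 : HasDerivWithinAt (fun τ => (e τ : Mat n)) e' s t :=
    (lieAlg G).subtypeL.hasFDerivAt.comp_hasDerivWithinAt t he
  have h2 := ((hg t).hasDerivWithinAt.mul h1).mul (hasDerivAt_mat_inv hg t).hasDerivWithinAt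
  have h3 := (LinearMap.toContinuousLinearMap (prl G)).hasFDerivAt.comp_hasDerivWithinAt t h2
  simp only [Ad_eq_prl]
  refine h3.congr_deriv ?_
  refine congrArg (prl G) ?_
  simp only [bracket, Submodule.coe_sub, Pi.mul_apply]
  noncomm_ring

omit hg

/-- Two-sided bounds of `g₀ g₀ᵀ` bound `g₀` and its inverse. -/
lemma exists_norm_mat_le (hg₀ : ∃ a b : ℝ, 0 < a ∧ a ≤ b ∧ ∀ t,
      (mat (g₀ t) * (mat (g₀ t))ᵀ - a • (1 : Mat n)).PosSemidef ∧
      (b • (1 : Mat n) - mat (g₀ t) * (mat (g₀ t))ᵀ).PosSemidef) :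
    ∃ C > 0, ∀ t, ‖mat (g₀ t)‖ ≤ C ∧ ‖mat (g₀ t)⁻¹‖ ≤ C := by
  obtain ⟨a, b, ha, hab, h⟩ := hg₀
  have hb : 0 < b := ha.trans_le hab
  refine ⟨max (√(b * n)) (√(n / a)) + 1, by positivity, fun t => ⟨?_, ?_⟩⟩
  · refine (Real.le_sqrt_of_sq_le ?_).trans ((le_max_left _ _).trans (lt_add_one _).le)
    have h1 := (h t).2.trace_nonneg
    rw [Matrix.trace_sub, Matrix.trace_smul, Matrix.trace_one, Matrix.trace_mul_comm,
      ← frob_apply, frob_self] at h1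
    simpa using h1
  · refine (Real.le_sqrt_of_sq_le ?_).trans ((le_max_right _ _).trans (lt_add_one _).le)
    have h1 := ((h t).1.mul_mul_conjTranspose_same (mat (g₀ t)⁻¹)).trace_nonneg
    have h2 := mat_inv_mul (g₀ t)
    have h3 : mat (g₀ t)⁻¹ * (mat (g₀ t) * (mat (g₀ t))ᵀ - a • (1 : Mat n)) * (mat (g₀ t)⁻¹)ᵀ
        = 1 - a • (mat (g₀ t)⁻¹ * (mat (g₀ t)⁻¹)ᵀ) := by
      have h4 : (mat (g₀ t))ᵀ * (mat (g₀ t)⁻¹)ᵀ = 1 := by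
        rw [← Matrix.transpose_mul, h2, Matrix.transpose_one]
      rw [Matrix.mul_sub, Matrix.sub_mul, ← Matrix.mul_assoc, h2, Matrix.one_mul, h4]
      simp
    rw [Matrix.conjTranspose_eq_transpose_of_trivial, h3, Matrix.trace_sub, Matrix.trace_smul,
      Matrix.trace_one, Matrix.trace_mul_comm, ← frob_apply, frob_self] at h1
    rw [le_div_iff₀ ha]
    simp at h1
    linarith

end Reference

/-! ### Normal form of the closed loop and its Lyapunov function -/

section NormalForm

attribute [-instance] instTopologicalSpaceMatrix Matrix.instUniformSpace

variable {n m : ℕ} {G : Subgroup (GL (Fin n) ℝ)}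

/-- The coordinates `(η, z, ω)` with `ω = g₀ e g₀⁻¹ + W`, the velocity of `z`. -/
noncomputable def coord (V : Mat n → ℝ) (α : ℝ) (g₀ : ℝ → G) (t : ℝ)
    (x : perp G × lieAlg G × lieAlg G) : perp G × lieAlg G × lieAlg G :=
  (x.1, x.2.1, Ad (g₀ t) x.2.2 + W V α g₀ t x.1)

/-- The velocity of `coord` along a curve with state `x` and velocity `x'` at time `t`. -/
noncomputable def coordVel (V : Mat n → ℝ) (α : ℝ) (g₀ : ℝ → G) (ξ₀ : ℝ → lieAlg G) (t : ℝ)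
    (x x' : perp G × lieAlg G × lieAlg G) : perp G × lieAlg G × lieAlg G :=
  (x'.1, x'.2.1, Ad (g₀ t) (x'.2.2 - bracket x.2.2 (ξ₀ t)) +
    (W V α g₀ t x'.1 + WPartial V α g₀ ξ₀ t x.1))

/-- The closed loop in the coordinates `coord`: the transversal dynamics, decoupled from a linear
system with constant coefficients. -/
noncomputable def normalField (V : Mat n → ℝ) (α : ℝ) (g₀ : ℝ → G) (Kp Kd : lieAlg G →ₗ[ℝ] lieAlg G)
    (t : ℝ) (y : perp G × lieAlg G × lieAlg G) : perp G × lieAlg G × lieAlg G :=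
  (perpField V α g₀ t y.1, y.2.2, Kp y.2.1 + Kd y.2.2)

lemma coordVel_add (V : Mat n → ℝ) (α : ℝ) (g₀ : ℝ → G) (ξ₀ : ℝ → lieAlg G) (t : ℝ)
    (x x' R : perp G × lieAlg G × lieAlg G) :
    coordVel V α g₀ ξ₀ t x (x' + R) = coordVel V α g₀ ξ₀ t x x' + coord V α g₀ t R := by
  simp only [coordVel, coord, Prod.fst_add, Prod.snd_add, Prod.mk_add_mk, W_add, map_sub, map_add]
  congr 2
  abel

/-- The feedback turns the split linearized dynamics into the normal form. -/
lemma coordVel_splitField {f : lieAlg G → Ctrl m → lieAlg G}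
    (hfu : ∀ ξ u, (dfdu f ξ u).IsInvertible) (V : Mat n → ℝ) (α : ℝ) (g₀ : ℝ → G)
    (ξ₀ : ℝ → lieAlg G) (u₀ : ℝ → Ctrl m) (Kp Kd : lieAlg G →ₗ[ℝ] lieAlg G) (t : ℝ)
    (x : perp G × lieAlg G × lieAlg G) :
    coordVel V α g₀ ξ₀ t x
        (splitField f V α g₀ ξ₀ u₀ (feedback f V α g₀ ξ₀ u₀ Kp Kd) t x)
      = normalField V α g₀ Kp Kd t (coord V α g₀ t x) := by
  have h1 : ∀ y, dfdu f (ξ₀ t) (u₀ t) ((dfdu f (ξ₀ t) (u₀ t)).inverse y) = y := fun y => by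
    obtain ⟨A, hA⟩ := hfu (ξ₀ t) (u₀ t)
    rw [← hA, ContinuousLinearMap.inverse_equiv]
    exact A.apply_symm_apply y
  simp only [coordVel, splitField, normalField, coord, feedback, h1]
  refine Prod.ext rfl (Prod.ext ?_ ?_)
  · exact sub_eq_add_neg _ _
  · have h2 : ∀ a b c : lieAlg G, a + (b + c - a) - b = c := fun a b c => by abel
    simp only [h2, Y, Ad_Ad_inv, Wdot_eq]
    abel

lemma hasDerivWithinAt_coord {g₀ : ℝ → G} {ξ₀ : ℝ → lieAlg G}
    (hg : ∀ t, HasDerivAt (fun s => mat (g₀ s)) (mat (g₀ t) * (ξ₀ t : Mat n)) t)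
    (V : Mat n → ℝ) (α : ℝ) {x : ℝ → perp G × lieAlg G × lieAlg G}
    {x' : perp G × lieAlg G × lieAlg G} {s : Set ℝ} {t : ℝ} (hx : HasDerivWithinAt x x' s t) :
    HasDerivWithinAt (fun τ => coord V α g₀ τ (x τ)) (coordVel V α g₀ ξ₀ t (x t) x') s t := by
  have h1 : HasDerivWithinAt (fun τ => (x τ).1) x'.1 s t :=
    (ContinuousLinearMap.fst ℝ (perp G) (lieAlg G × lieAlg G)).hasFDerivAt.comp_hasDerivWithinAt
      t hx
  have h2 : HasDerivWithinAt (fun τ => (x τ).2) x'.2 s t :=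
    (ContinuousLinearMap.snd ℝ (perp G) (lieAlg G × lieAlg G)).hasFDerivAt.comp_hasDerivWithinAt
      t hx
  have h3 : HasDerivWithinAt (fun τ => (x τ).2.1) x'.2.1 s t :=
    (ContinuousLinearMap.fst ℝ (lieAlg G) (lieAlg G)).hasFDerivAt.comp_hasDerivWithinAt t h2
  have h4 : HasDerivWithinAt (fun τ => (x τ).2.2) x'.2.2 s t :=
    (ContinuousLinearMap.snd ℝ (lieAlg G) (lieAlg G)).hasFDerivAt.comp_hasDerivWithinAt t h2
  exact h1.prodMk (h3.prodMk ((hasDerivWithinAt_Ad hg h4).add (hasDerivWithinAt_W hg V α h1)))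

lemma norm_mul_mul_le_sq {A B X : Mat n} {C : ℝ} (hA : ‖A‖ ≤ C) (hB : ‖B‖ ≤ C) :
    ‖A * X * B‖ ≤ C ^ 2 * ‖X‖ := by
  have hC : 0 ≤ C := (norm_nonneg _).trans hA
  calc ‖A * X * B‖ ≤ ‖A‖ * ‖X‖ * ‖B‖ :=
        (norm_mul_le _ _).trans (mul_le_mul_of_nonneg_right (norm_mul_le _ _) (norm_nonneg _))
    _ ≤ C * ‖X‖ * C := by gcongr
    _ = C ^ 2 * ‖X‖ := by ring

lemma norm_gramInv_le {g₀ : ℝ → G} {C : ℝ} {t : ℝ} (h : ‖mat (g₀ t)⁻¹‖ ≤ C) :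
    ‖gramInv g₀ t‖ ≤ C ^ 2 := by
  have hC : 0 ≤ C := (norm_nonneg _).trans h
  rw [gramInv_eq, sq]
  refine (norm_mul_le _ _).trans ?_
  rw [Matrix.frobenius_norm_transpose]
  gcongr

lemma exists_norm_W_le (V : Mat n → ℝ) (α : ℝ) {g₀ : ℝ → G} {C : ℝ}
    (hC : ∀ t, ‖mat (g₀ t)‖ ≤ C ∧ ‖mat (g₀ t)⁻¹‖ ≤ C) :
    ∃ Q ≥ 0, ∀ t η, ‖W V α g₀ t η‖ ≤ Q * ‖η‖ := by
  let H : Mat n →L[ℝ] Mat n := LinearMap.toContinuousLinearMap (hess V 1 : Mat n →ₗ[ℝ] Mat n)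
  let p : Mat n →L[ℝ] lieAlg G := LinearMap.toContinuousLinearMap (prl G)
  refine ⟨|α| * (‖p‖ * (‖H‖ * C ^ 2)), by positivity, fun t η => ?_⟩
  have h1 : ‖H (η : Mat n) * gramInv g₀ t‖ ≤ ‖H‖ * ‖η‖ * C ^ 2 :=
    (norm_mul_le _ _).trans (mul_le_mul (H.le_opNorm _) (norm_gramInv_le (hC t).2)
      (norm_nonneg _) (by positivity))
  change ‖-(α • p (H (η : Mat n) * gramInv g₀ t))‖ ≤ _
  rw [norm_neg, norm_smul, Real.norm_eq_abs]
  calc |α| * ‖p (H (η : Mat n) * gramInv g₀ t)‖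
      ≤ |α| * (‖p‖ * (‖H‖ * ‖η‖ * C ^ 2)) := by
        gcongr
        exact (p.le_opNorm _).trans (by gcongr)
    _ = _ := by ring

lemma norm_Ad_le {g : G} {C : ℝ} (hg : ‖mat g‖ ≤ C) (hg' : ‖mat g⁻¹‖ ≤ C) (e : lieAlg G) :
    ‖Ad g e‖ ≤ C ^ 2 * ‖e‖ :=
  norm_mul_mul_le_sq hg hg'

lemma exists_norm_coord_le (V : Mat n → ℝ) (α : ℝ) {g₀ : ℝ → G} {C : ℝ}
    (hC : ∀ t, ‖mat (g₀ t)‖ ≤ C ∧ ‖mat (g₀ t)⁻¹‖ ≤ C) :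
    ∃ Q > 0, ∀ t x, ‖coord V α g₀ t x‖ ≤ Q * ‖x‖ ∧ ‖x‖ ≤ Q * ‖coord V α g₀ t x‖ := by
  obtain ⟨Q, hQ, hW⟩ := exists_norm_W_le V α hC
  refine ⟨1 + C ^ 2 * (1 + Q) + Q, by positivity, fun t x => ⟨?_, ?_⟩⟩
  · have h1 := norm_fst_le x
    have h2 := (norm_fst_le x.2).trans (norm_snd_le x)
    have h3 := (norm_snd_le x.2).trans (norm_snd_le x)
    refine norm_prod_le_iff.2 ⟨?_, norm_prod_le_iff.2 ⟨?_, ?_⟩⟩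
    · refine h1.trans (le_mul_of_one_le_left (norm_nonneg _) ?_)
      have : 0 ≤ C ^ 2 * (1 + Q) := by positivity
      linarith
    · refine h2.trans (le_mul_of_one_le_left (norm_nonneg _) ?_)
      have : 0 ≤ C ^ 2 * (1 + Q) := by positivity
      linarith
    · calc ‖Ad (g₀ t) x.2.2 + W V α g₀ t x.1‖ ≤ C ^ 2 * ‖x.2.2‖ + Q * ‖x.1‖ :=
            (norm_add_le _ _).trans (add_le_add (norm_Ad_le (hC t).1 (hC t).2 _) (hW t _))
        _ ≤ C ^ 2 * ‖x‖ + Q * ‖x‖ := by gcongr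
        _ ≤ (1 + C ^ 2 * (1 + Q) + Q) * ‖x‖ := by
            have : 0 ≤ C ^ 2 * Q * ‖x‖ := by positivity
            nlinarith [norm_nonneg x]
  · set y := coord V α g₀ t x with hy
    have h1 : ‖x.1‖ ≤ ‖y‖ := norm_fst_le y
    have h2 : ‖x.2.1‖ ≤ ‖y‖ := (norm_fst_le y.2).trans (norm_snd_le y)
    have h3 : ‖y.2.2‖ ≤ ‖y‖ := (norm_snd_le y.2).trans (norm_snd_le y)
    have h4 : x.2.2 = Ad (g₀ t)⁻¹ (y.2.2 - W V α g₀ t x.1) := by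
      simp only [hy, coord, add_sub_cancel_right, Ad_inv_Ad]
    refine norm_prod_le_iff.2 ⟨?_, norm_prod_le_iff.2 ⟨?_, ?_⟩⟩
    · refine h1.trans (le_mul_of_one_le_left (norm_nonneg _) ?_)
      have : 0 ≤ C ^ 2 * (1 + Q) := by positivity
      linarith
    · refine h2.trans (le_mul_of_one_le_left (norm_nonneg _) ?_)
      have : 0 ≤ C ^ 2 * (1 + Q) := by positivity
      linarith
    · rw [h4]
      calc _ ≤ C ^ 2 * ‖y.2.2 - W V α g₀ t x.1‖ :=
            norm_Ad_le (hC t).2 (by rw [inv_inv]; exact (hC t).1) _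
        _ ≤ C ^ 2 * (‖y‖ + Q * ‖y‖) := by
            gcongr
            refine (norm_sub_le _ _).trans (add_le_add h3 ((hW t _).trans ?_))
            gcongr
        _ ≤ (1 + C ^ 2 * (1 + Q) + Q) * ‖y‖ := by
            nlinarith [norm_nonneg y, mul_nonneg hQ (norm_nonneg y)]

/-- The bilinear form `⟨Q η, η'⟩ + trace ([z; ω]ᵀ S [z'; ω'])`, with `[z; ω]` the matrix `z` on top
of the matrix `ω`. -/
noncomputable def blockForm (G : Subgroup (GL (Fin n) ℝ)) (Q : Mat n →ₗ[ℝ] Mat n)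
    (S : Matrix (Fin n ⊕ Fin n) (Fin n ⊕ Fin n) ℝ) :
    (perp G × lieAlg G × lieAlg G) →L[ℝ] (perp G × lieAlg G × lieAlg G) →L[ℝ] ℝ :=
  let stack : perp G × lieAlg G × lieAlg G →ₗ[ℝ] Matrix (Fin n ⊕ Fin n) (Fin n) ℝ :=
    { toFun := fun x => Matrix.fromRows (x.2.1 : Mat n) (x.2.2 : Mat n)
      map_add' := fun x y => by ext (i | i) j <;> rfl
      map_smul' := fun c x => by ext (i | i) j <;> rfl }
  LinearMap.toContinuousBilinearMap <| LinearMap.mk₂ ℝ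
    (fun x y => frob n (Q (x.1 : Mat n)) (y.1 : Mat n) + ((stack x)ᵀ * S * stack y).trace)
    (fun x x' y => by
      simp only [Prod.fst_add, Submodule.coe_add, map_add, LinearMap.add_apply,
        Matrix.transpose_add, Matrix.add_mul, Matrix.trace_add]
      ring)
    (fun c x y => by
      simp only [Prod.smul_fst, Submodule.coe_smul, map_smul, LinearMap.smul_apply,
        Matrix.transpose_smul, Matrix.smul_mul, Matrix.trace_smul, smul_add])
    (fun x y y' => by
      simp only [Prod.fst_add, Submodule.coe_add, map_add, Matrix.mul_add, Matrix.trace_add]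
      ring)
    (fun c x y => by
      simp only [Prod.smul_fst, Submodule.coe_smul, map_smul, Matrix.mul_smul, Matrix.trace_smul,
        smul_add])

lemma blockForm_apply (Q : Mat n →ₗ[ℝ] Mat n) (S : Matrix (Fin n ⊕ Fin n) (Fin n ⊕ Fin n) ℝ)
    (x y : perp G × lieAlg G × lieAlg G) :
    blockForm G Q S x y = frob n (Q (x.1 : Mat n)) (y.1 : Mat n) +
      ((Matrix.fromRows (x.2.1 : Mat n) (x.2.2 : Mat n))ᵀ * S *
        Matrix.fromRows (y.2.1 : Mat n) (y.2.2 : Mat n)).trace := rfl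

lemma trace_transpose_mul_self_pos {ι κ : Type} [Fintype ι] [Fintype κ] {X : Matrix ι κ ℝ}
    (hX : X ≠ 0) : 0 < (Xᵀ * X).trace := by
  have h := (Matrix.posSemidef_conjTranspose_mul_self X).trace_nonneg
  rw [Matrix.conjTranspose_eq_transpose_of_trivial] at h
  refine lt_of_le_of_ne h fun h0 => hX ?_
  refine Matrix.trace_conjTranspose_mul_self_eq_zero_iff.1 ?_
  rw [Matrix.conjTranspose_eq_transpose_of_trivial, ← h0]

lemma exists_blockForm_ge {Q : Mat n →ₗ[ℝ] Mat n} {S : Matrix (Fin n ⊕ Fin n) (Fin n ⊕ Fin n) ℝ}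
    (hQ : ∀ η ∈ perp G, η ≠ 0 → 0 < frob n (Q η) η)
    (hS : ∀ X : Matrix (Fin n ⊕ Fin n) (Fin n) ℝ, X ≠ 0 → 0 < (Xᵀ * S * X).trace) :
    ∃ c > 0, ∀ x, c * ‖x‖ ^ 2 ≤ blockForm G Q S x x := by
  refine exists_pos_mul_norm_sq_le _ fun x hx => ?_
  rw [blockForm_apply]
  have hQ' : 0 ≤ frob n (Q (x.1 : Mat n)) (x.1 : Mat n) := by
    rcases eq_or_ne (x.1 : Mat n) 0 with h | h
    · rw [h]; simp
    · exact (hQ _ x.1.2 h).le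
  by_cases h : Matrix.fromRows (x.2.1 : Mat n) (x.2.2 : Mat n) = 0
  · rw [h]
    have h1 : x.2.1 = 0 := by
      ext i j; exact congrFun (congrFun h (Sum.inl i)) j
    have h2 : x.2.2 = 0 := by
      ext i j; exact congrFun (congrFun h (Sum.inr i)) j
    have h3 : (x.1 : Mat n) ≠ 0 := fun h0 => hx (Prod.ext (Subtype.ext h0) (Prod.ext h1 h2))
    simpa using hQ _ x.1.2 h3
  · exact add_pos_of_nonneg_of_pos hQ' (hS _ h)

end NormalForm

section LyapunovFunction

attribute [-instance] instTopologicalSpaceMatrix Matrix.instUniformSpace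

variable {n m : ℕ} {G : Subgroup (GL (Fin n) ℝ)}

/-- The transversal part dissipates: `⟨H η, (H η P)^⊥⟩ = ‖H η g₀⁻ᵀ‖²`, since the Hessian `H` maps
into `𝔤^⊥`. -/
lemma IsTransversal.frob_hess_perpField_le {V : Mat n → ℝ} (hV : IsTransversal G V) {α : ℝ}
    (hα : 0 < α) {g₀ : ℝ → G} {C : ℝ} (hC0 : 0 < C) {t : ℝ} (hC : ‖mat (g₀ t)‖ ≤ C) (η : perp G) :
    frob n (hess V 1 (η : Mat n)) (perpField V α g₀ t η : Mat n) ≤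
      -(α / C ^ 2 * ‖hess V 1 (η : Mat n)‖ ^ 2) := by
  set A := hess V 1 (η : Mat n) with hA
  have h1 : frob n A (perpField V α g₀ t η : Mat n) = -(α * ‖A * (mat (g₀ t)⁻¹)ᵀ‖ ^ 2) := by
    have h2 : (perpField V α g₀ t η : Mat n) = -(α • (prp G (A * gramInv g₀ t) : Mat n)) := rfl
    rw [h2, map_neg, map_smul, frob_prp (hV.hess_mem_perp _), gramInv_eq, smul_eq_mul, ← frob_self,
      frob_apply, frob_apply, Matrix.transpose_mul, Matrix.transpose_transpose,
      ← Matrix.mul_assoc A, ← Matrix.mul_assoc Aᵀ, Matrix.trace_mul_comm, Matrix.mul_assoc]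
  have h3 : A = A * (mat (g₀ t)⁻¹)ᵀ * (mat (g₀ t))ᵀ := by
    rw [Matrix.mul_assoc, ← Matrix.transpose_mul, mat_mul_inv, Matrix.transpose_one, Matrix.mul_one]
  have h4 : ‖A‖ ≤ ‖A * (mat (g₀ t)⁻¹)ᵀ‖ * C := by
    conv_lhs => rw [h3]
    refine (norm_mul_le _ _).trans ?_
    rw [Matrix.frobenius_norm_transpose]
    gcongr
  have h5 : ‖A‖ ^ 2 ≤ ‖A * (mat (g₀ t)⁻¹)ᵀ‖ ^ 2 * C ^ 2 := by
    rw [← mul_pow]; gcongr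
  rw [h1, neg_le_neg_iff, div_mul_eq_mul_div, div_le_iff₀ (by positivity)]
  nlinarith

lemma fromBlocks_mul_fromRows_leftMul {Kp Kd : Mat n} (hKp : ∀ X ∈ lieAlg G, Kp * X ∈ lieAlg G)
    (hKd : ∀ X ∈ lieAlg G, Kd * X ∈ lieAlg G) (z w : lieAlg G) :
    Matrix.fromBlocks 0 1 Kp Kd * Matrix.fromRows (z : Mat n) (w : Mat n)
      = Matrix.fromRows (w : Mat n) (leftMul Kp hKp z + leftMul Kd hKd w : lieAlg G) := by
  rw [Matrix.fromBlocks_mul_fromRows]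
  simp [leftMul]

/-- A quadratic Lyapunov function of the closed split dynamics, uniform in time, that still decays
under a perturbation of the velocity that is small relative to the state. Its derivative along a
curve with velocity `x'` is `dv t x x'`. -/
lemma exists_lyapunov_splitField {V : Mat n → ℝ} (hV : IsTransversal G V) {α : ℝ} (hα : 0 < α)
    {f : lieAlg G → Ctrl m → lieAlg G} (hfu : ∀ ξ u, (dfdu f ξ u).IsInvertible)
    {g₀ : ℝ → G} {ξ₀ : ℝ → lieAlg G} (u₀ : ℝ → Ctrl m)
    (hg : ∀ t, HasDerivAt (fun s => mat (g₀ s)) (mat (g₀ t) * (ξ₀ t : Mat n)) t)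
    {C : ℝ} (hC0 : 0 < C) (hC : ∀ t, ‖mat (g₀ t)‖ ≤ C ∧ ‖mat (g₀ t)⁻¹‖ ≤ C)
    {Kp Kd : Mat n} (hKp : ∀ X ∈ lieAlg G, Kp * X ∈ lieAlg G)
    (hKd : ∀ X ∈ lieAlg G, Kd * X ∈ lieAlg G)
    (hK : IsHurwitz (Matrix.fromBlocks 0 1 Kp Kd)) :
    ∃ (v : ℝ → perp G × lieAlg G × lieAlg G → ℝ)
      (dv : ℝ → perp G × lieAlg G × lieAlg G → perp G × lieAlg G × lieAlg G → ℝ) (c k l ε : ℝ),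
      0 < c ∧ 0 < k ∧ 0 < l ∧ 0 < ε ∧
      (∀ (x : ℝ → perp G × lieAlg G × lieAlg G) (x' : perp G × lieAlg G × lieAlg G) (s : Set ℝ)
        (t : ℝ), HasDerivWithinAt x x' s t →
        HasDerivWithinAt (fun τ => v τ (x τ)) (dv t (x t) x') s t) ∧
      (∀ t x, c * ‖x‖ ^ 2 ≤ v t x) ∧ (∀ t x, v t x ≤ c * k ^ 2 * ‖x‖ ^ 2) ∧
      ∀ t x R, ‖R‖ ≤ ε * ‖x‖ →
        dv t x (splitField f V α g₀ ξ₀ u₀ (feedback f V α g₀ ξ₀ u₀ (leftMul Kp hKp)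
          (leftMul Kd hKd)) t x + R) ≤ -(2 * l) * v t x := by
  obtain ⟨S, N, hST, hN, hSN, hS1⟩ := exists_lyapunov_of_isHurwitz hK
  obtain ⟨Q, hQ0, hQ⟩ := exists_norm_coord_le V α hC
  let H : Mat n →ₗ[ℝ] Mat n := (hess V 1 : Mat n →ₗ[ℝ] Mat n)
  have hSpos : ∀ X : Matrix (Fin n ⊕ Fin n) (Fin n) ℝ, X ≠ 0 → 0 < (Xᵀ * S * X).trace :=
    fun X hX => (trace_transpose_mul_self_pos hX).trans_le (hS1 X)
  have hNpos : ∀ X : Matrix (Fin n ⊕ Fin n) (Fin n) ℝ, X ≠ 0 →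
      0 < (Xᵀ * (Nᵀ * N) * X).trace := fun X hX => by
    have h1 : Xᵀ * (Nᵀ * N) * X = (N * X)ᵀ * (N * X) := by
      rw [Matrix.transpose_mul]; simp only [Matrix.mul_assoc]
    rw [h1]
    refine trace_transpose_mul_self_pos fun h0 => hX ?_
    obtain ⟨N', hN'⟩ := hN.exists_left_inv
    calc X = N' * N * X := by rw [hN', Matrix.one_mul]
      _ = 0 := by rw [Matrix.mul_assoc, h0, Matrix.mul_zero]
  obtain ⟨b, hb0, hb⟩ := exists_blockForm_ge (G := G) (Q := H) (S := S) hV.posDef hSpos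
  -- the dissipation along the normal form is at least this second quadratic form
  obtain ⟨d, hd0, hd⟩ := exists_blockForm_ge (G := G) (Q := (2 * (α / C ^ 2)) • (H ∘ₗ H))
    (S := Nᵀ * N) (fun η hη hη0 => by
      have h1 : frob n (((2 * (α / C ^ 2)) • (H ∘ₗ H)) η) η
          = 2 * (α / C ^ 2) * ‖hess V 1 η‖ ^ 2 := by
        rw [← frob_self, ← frob_hess_comm hV.contDiff, LinearMap.smul_apply, map_smul]
        rfl
      have h2 : hess V 1 η ≠ 0 := fun h0 => by
        have := hV.posDef η hη hη0
        rw [h0] at this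
        simp at this
      have h3 : 0 < ‖hess V 1 η‖ := norm_pos_iff.2 h2
      rw [h1]
      positivity) hNpos
  set B := blockForm G H S with hB
  have hBsymm : ∀ x y, B x y = B y x := fun x y => by
    rw [hB, blockForm_apply, blockForm_apply]
    refine congrArg₂ (· + ·) ?_ ?_
    · exact frob_hess_comm hV.contDiff 1 _ _
    · rw [← Matrix.trace_transpose, Matrix.transpose_mul, Matrix.transpose_mul,
        Matrix.transpose_transpose, hST, Matrix.mul_assoc]
  have hdiss : ∀ t y, 2 * B y (normalField V α g₀ (leftMul Kp hKp) (leftMul Kd hKd) t y)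
      ≤ -(d * ‖y‖ ^ 2) := fun t y => by
    refine le_trans ?_ (neg_le_neg (hd y))
    rw [hB, blockForm_apply, blockForm_apply, mul_add, neg_add]
    refine add_le_add ?_ (le_of_eq ?_)
    · have h1 := hV.frob_hess_perpField_le hα hC0 (hC t).1 y.1
      have h2 : frob n (((2 * (α / C ^ 2)) • (H ∘ₗ H)) y.1) y.1
          = 2 * (α / C ^ 2 * ‖hess V 1 (y.1 : Mat n)‖ ^ 2) := by
        rw [← frob_self, ← frob_hess_comm hV.contDiff, LinearMap.smul_apply, map_smul, ← mul_assoc]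
        rfl
      rw [h2]
      have h3 : frob n (H (y.1 : Mat n))
            ((normalField V α g₀ (leftMul Kp hKp) (leftMul Kd hKd) t y).1)
          = frob n (hess V 1 (y.1 : Mat n)) (perpField V α g₀ t y.1 : Mat n) := rfl
      rw [h3]
      linarith
    · set X := Matrix.fromRows (y.2.1 : Mat n) (y.2.2 : Mat n) with hX
      have h1 : Matrix.fromRows
          ((normalField V α g₀ (leftMul Kp hKp) (leftMul Kd hKd) t y).2.1 : Mat n)
          ((normalField V α g₀ (leftMul Kp hKp) (leftMul Kd hKd) t y).2.2 : Mat n)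
          = Matrix.fromBlocks 0 1 Kp Kd * X :=
        (fromBlocks_mul_fromRows_leftMul hKp hKd y.2.1 y.2.2).symm
      rw [h1]
      generalize (Matrix.fromBlocks 0 1 Kp Kd : Matrix (Fin n ⊕ Fin n) (Fin n ⊕ Fin n) ℝ) = M
        at hSN ⊢
      have h2 : Nᵀ * N = -(Mᵀ * S + S * M) := by rw [hSN, neg_neg]
      have h3 : (Xᵀ * S * (M * X)).trace = (Xᵀ * (Mᵀ * S) * X).trace := by
        rw [← Matrix.trace_transpose]
        simp only [Matrix.transpose_mul, Matrix.transpose_transpose, hST, Matrix.mul_assoc]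
      rw [h2, Matrix.mul_neg, Matrix.neg_mul, Matrix.trace_neg, Matrix.mul_add, Matrix.add_mul,
        Matrix.trace_add, ← h3, ← Matrix.mul_assoc Xᵀ S M, Matrix.mul_assoc (Xᵀ * S) M X]
      ring
  obtain ⟨β, hβ0, hBle⟩ := exists_bilin_le B
  refine ⟨fun t x => B (coord V α g₀ t x) (coord V α g₀ t x),
    fun t x x' => 2 * B (coord V α g₀ t x) (coordVel V α g₀ ξ₀ t x x'),
    b / Q ^ 2, √(β * Q ^ 2 / (b / Q ^ 2)), d / (4 * β), d / (4 * β * Q ^ 2),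
    by positivity, by positivity, by positivity, by positivity, ?_, ?_, ?_, ?_⟩
  · intro x x' s t hx
    have h1 := hasDerivWithinAt_coord hg V α hx
    exact hasDerivWithinAt_quadratic hBsymm h1
  · intro t x
    refine le_trans ?_ (hb _)
    rw [div_mul_eq_mul_div, div_le_iff₀ (by positivity), mul_assoc, ← mul_pow, mul_comm _ Q]
    gcongr
    exact (hQ t x).2
  · intro t x
    rw [Real.sq_sqrt (by positivity), mul_div_cancel₀ _ (by positivity)]
    refine (hBle _ _).trans ?_
    rw [mul_assoc, mul_assoc, ← sq, ← mul_pow]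
    gcongr
    exact (hQ t x).1
  · intro t x R hR
    set y := coord V α g₀ t x with hy
    dsimp only
    rw [coordVel_add, coordVel_splitField hfu, map_add, mul_add]
    have h1 := hdiss t y
    have h2 : B y (coord V α g₀ t R) ≤ d / 4 * ‖y‖ ^ 2 := by
      calc B y (coord V α g₀ t R) ≤ β * ‖y‖ * (Q * (d / (4 * β * Q ^ 2) * (Q * ‖y‖))) := by
            refine (hBle _ _).trans ?_
            gcongr
            refine (hQ t R).1.trans ?_
            gcongr
            refine hR.trans ?_
            gcongr
            exact (hQ t x).2
        _ = d / 4 * ‖y‖ ^ 2 := by field_simp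
    have h3 : 2 * (d / (4 * β)) * B y y ≤ d / 2 * ‖y‖ ^ 2 := by
      calc 2 * (d / (4 * β)) * B y y ≤ 2 * (d / (4 * β)) * (β * ‖y‖ * ‖y‖) := by
            gcongr; exact hBle y y
        _ = d / 2 * ‖y‖ ^ 2 := by field_simp; norm_num
    linarith

end LyapunovFunction

/-! ### The closed loop as a function of the reference data -/

section Parameters

attribute [-instance] instTopologicalSpaceMatrix Matrix.instUniformSpace

open ContinuousLinearMap

variable {n m : ℕ} {G : Subgroup (GL (Fin n) ℝ)}

/-- Transposition as a continuous linear map. -/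
noncomputable def transposeL (n : ℕ) : Mat n →L[ℝ] Mat n :=
  LinearMap.toContinuousLinearMap (Matrix.transposeLinearEquiv (Fin n) (Fin n) ℝ ℝ).toLinearMap

/-- The projection onto the Lie algebra as a continuous linear map. -/
noncomputable def prlL (G : Subgroup (GL (Fin n) ℝ)) : Mat n →L[ℝ] lieAlg G :=
  LinearMap.toContinuousLinearMap (prl G)

/-- The projection onto `𝔤^⊥` as a continuous linear map. -/
noncomputable def prpL (G : Subgroup (GL (Fin n) ℝ)) : Mat n →L[ℝ] perp G :=
  LinearMap.toContinuousLinearMap (prp G)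

/-- The Hessian at the identity, restricted to `𝔤^⊥` and multiplied on the right by `P`. -/
noncomputable def hessMulL (G : Subgroup (GL (Fin n) ℝ)) (V : Mat n → ℝ) (P : Mat n) :
    perp G →L[ℝ] Mat n :=
  (ContinuousLinearMap.mul ℝ (Mat n)).flip P ∘L
    LinearMap.toContinuousLinearMap ((hess V 1 : Mat n →ₗ[ℝ] Mat n) ∘ₗ (perp G).subtype)

/-- `A ↦ (M A M')^∥` on the Lie algebra; for `M = g ∈ G` and `M' = g⁻¹` this is `Ad g`. -/
noncomputable def adL (G : Subgroup (GL (Fin n) ℝ)) (M M' : Mat n) : lieAlg G →L[ℝ] lieAlg G :=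
  prlL G ∘L ContinuousLinearMap.mul ℝ (Mat n) M ∘L
    (ContinuousLinearMap.mul ℝ (Mat n)).flip M' ∘L (lieAlg G).subtypeL

/-- `P = (g gᵀ)⁻¹` as a function of `M' = g⁻¹`. -/
noncomputable def gramL (M' : Mat n) : Mat n := transposeL n M' * M'

/-- `Ṗ` as a function of `M' = g⁻¹` and `ξ = g⁻¹ ġ`. -/
noncomputable def gramDotL (M' ξ : Mat n) : Mat n :=
  -(transposeL n M' * ξ * M' + transposeL n M' * transposeL n ξ * M')

/-- The transversal dynamics as a continuous linear map, for `M'` in place of `g₀⁻¹`. -/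
noncomputable def perpFieldL (G : Subgroup (GL (Fin n) ℝ)) (V : Mat n → ℝ) (α : ℝ) (M' : Mat n) :
    perp G →L[ℝ] perp G := -(α • (prpL G ∘L hessMulL G V (gramL M')))

/-- `W` as a continuous linear map, for an arbitrary matrix in place of `P`; with `Ṗ` in that place
it is the partial derivative of `W` in time. -/
noncomputable def WL (G : Subgroup (GL (Fin n) ℝ)) (V : Mat n → ℝ) (α : ℝ) (P : Mat n) :
    perp G →L[ℝ] lieAlg G := -(α • (prlL G ∘L hessMulL G V P))

/-- The feedback as a continuous linear map of the state, for `M` and `M'` in place of `g₀` and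
`g₀⁻¹`. -/
noncomputable def feedbackL (f : lieAlg G → Ctrl m → lieAlg G) (V : Mat n → ℝ) (α : ℝ)
    (Kp Kd : lieAlg G →ₗ[ℝ] lieAlg G) (p : Mat n × Mat n × lieAlg G × Ctrl m) :
    (perp G × lieAlg G × lieAlg G) →L[ℝ] Ctrl m :=
  let η : (perp G × lieAlg G × lieAlg G) →L[ℝ] perp G := fst ℝ _ _
  let z : (perp G × lieAlg G × lieAlg G) →L[ℝ] lieAlg G := fst ℝ _ _ ∘L snd ℝ _ _
  let e : (perp G × lieAlg G × lieAlg G) →L[ℝ] lieAlg G := snd ℝ _ _ ∘L snd ℝ _ _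
  (fderiv ℝ (fun v => f p.2.2.1 v) p.2.2.2).inverse ∘L
    (prlL G ∘L ((ContinuousLinearMap.mul ℝ (Mat n)).flip p.2.2.1
        - ContinuousLinearMap.mul ℝ (Mat n) p.2.2.1) ∘L (lieAlg G).subtypeL ∘L e
      + adL G p.2.1 p.1 ∘L
        (-((WL G V α (gramL p.2.1) ∘L perpFieldL G V α p.2.1
              + WL G V α (gramDotL p.2.1 p.2.2.1)) ∘L η)
          + LinearMap.toContinuousLinearMap Kp ∘L z
          + LinearMap.toContinuousLinearMap Kd ∘L
            (adL G p.1 p.2.1 ∘L e + WL G V α (gramL p.2.1) ∘L η))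
      - fderiv ℝ (fun ζ => f ζ p.2.2.2) p.2.2.1 ∘L e)

/-- The closed split field as a continuous linear map of the state. -/
noncomputable def splitL (f : lieAlg G → Ctrl m → lieAlg G) (V : Mat n → ℝ) (α : ℝ)
    (Kp Kd : lieAlg G →ₗ[ℝ] lieAlg G) (p : Mat n × Mat n × lieAlg G × Ctrl m) :
    (perp G × lieAlg G × lieAlg G) →L[ℝ] (perp G × lieAlg G × lieAlg G) :=
  let η : (perp G × lieAlg G × lieAlg G) →L[ℝ] perp G := fst ℝ _ _
  let e : (perp G × lieAlg G × lieAlg G) →L[ℝ] lieAlg G := snd ℝ _ _ ∘L snd ℝ _ _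
  (perpFieldL G V α p.2.1 ∘L η).prod
    ((adL G p.1 p.2.1 ∘L e + WL G V α (gramL p.2.1) ∘L η).prod
      (fderiv ℝ (fun ζ => f ζ p.2.2.2) p.2.2.1 ∘L e
        + fderiv ℝ (fun v => f p.2.2.1 v) p.2.2.2 ∘L feedbackL f V α Kp Kd p))

/-- The data of the reference trajectory at time `t`. -/
noncomputable def refData (g₀ : ℝ → G) (ξ₀ : ℝ → lieAlg G) (u₀ : ℝ → Ctrl m) (t : ℝ) :
    Mat n × Mat n × lieAlg G × Ctrl m := (mat (g₀ t), mat (g₀ t)⁻¹, ξ₀ t, u₀ t)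

lemma adL_eq (g : G) (A : lieAlg G) : adL G (mat g) (mat g⁻¹) A = Ad g A := by
  rw [Ad_eq_prl, Matrix.mul_assoc]
  rfl

lemma gramL_eq (g₀ : ℝ → G) (t : ℝ) : gramL (mat (g₀ t)⁻¹) = gramInv g₀ t :=
  (gramInv_eq g₀ t).symm

lemma gramDotL_eq (g₀ : ℝ → G) (ξ₀ : ℝ → lieAlg G) (t : ℝ) :
    gramDotL (mat (g₀ t)⁻¹) (ξ₀ t : Mat n) = gramInvDot g₀ ξ₀ t :=
  (gramInvDot_eq g₀ ξ₀ t).symm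

lemma feedbackL_refData (f : lieAlg G → Ctrl m → lieAlg G) (V : Mat n → ℝ) (α : ℝ)
    (Kp Kd : lieAlg G →ₗ[ℝ] lieAlg G) (g₀ : ℝ → G) (ξ₀ : ℝ → lieAlg G) (u₀ : ℝ → Ctrl m) (t : ℝ)
    (x : perp G × lieAlg G × lieAlg G) :
    feedbackL f V α Kp Kd (refData g₀ ξ₀ u₀ t) x
      = feedback f V α g₀ ξ₀ u₀ Kp Kd t x.1 x.2.1 x.2.2 := by
  have hb : prlL G ((x.2.2 : Mat n) * (ξ₀ t : Mat n) - (ξ₀ t : Mat n) * (x.2.2 : Mat n))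
      = bracket x.2.2 (ξ₀ t) := prl_coe (bracket x.2.2 (ξ₀ t))
  have hY : adL G (mat (g₀ t)⁻¹) (mat (g₀ t))
      (-(WL G V α (gramL (mat (g₀ t)⁻¹)) (perpFieldL G V α (mat (g₀ t)⁻¹) x.1)
          + WL G V α (gramDotL (mat (g₀ t)⁻¹) (ξ₀ t)) x.1)
        + Kp x.2.1 + Kd (adL G (mat (g₀ t)) (mat (g₀ t)⁻¹) x.2.2
          + WL G V α (gramL (mat (g₀ t)⁻¹)) x.1))
      = Y V α g₀ ξ₀ Kp Kd t x.1 x.2.1 x.2.2 := by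
    have h := fun A => adL_eq (g₀ t)⁻¹ A
    simp only [inv_inv] at h
    rw [h, Y, Wdot_eq, adL_eq, gramL_eq, gramDotL_eq]
    have hp : perpFieldL G V α (mat (g₀ t)⁻¹) x.1 = perpField V α g₀ t x.1 := by
      rw [perpFieldL, gramL_eq]; rfl
    rw [hp]
    rfl
  rw [feedback, ← hb, ← hY]
  rfl

lemma splitL_refData (f : lieAlg G → Ctrl m → lieAlg G) (V : Mat n → ℝ) (α : ℝ)
    (Kp Kd : lieAlg G →ₗ[ℝ] lieAlg G) (g₀ : ℝ → G) (ξ₀ : ℝ → lieAlg G) (u₀ : ℝ → Ctrl m) (t : ℝ)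
    (x : perp G × lieAlg G × lieAlg G) :
    splitL f V α Kp Kd (refData g₀ ξ₀ u₀ t) x
      = splitField f V α g₀ ξ₀ u₀ (feedback f V α g₀ ξ₀ u₀ Kp Kd) t x := by
  have hp : perpFieldL G V α (mat (g₀ t)⁻¹) x.1 = perpField V α g₀ t x.1 := by
    rw [perpFieldL, gramL_eq]; rfl
  have h2 : adL G (mat (g₀ t)) (mat (g₀ t)⁻¹) x.2.2 + WL G V α (gramL (mat (g₀ t)⁻¹)) x.1
      = Ad (g₀ t) x.2.2 - α • prl G (hess V 1 (x.1 : Mat n) * gramInv g₀ t) := by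
    rw [adL_eq, gramL_eq, sub_eq_add_neg]; rfl
  rw [splitField, ← hp, ← h2, ← feedbackL_refData]
  rfl

section Continuity

lemma continuous_hessMulL (V : Mat n → ℝ) : Continuous (hessMulL G V) := by
  unfold hessMulL
  fun_prop

lemma continuous_gramL : Continuous (gramL (n := n)) := by
  unfold gramL
  fun_prop

lemma continuous_WL (V : Mat n → ℝ) (α : ℝ) : Continuous (WL G V α) := by
  unfold WL
  exact ((continuous_const.clm_comp (continuous_hessMulL V)).const_smul α).neg

lemma continuous_perpFieldL (V : Mat n → ℝ) (α : ℝ) : Continuous (perpFieldL G V α) := by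
  unfold perpFieldL
  exact ((continuous_const.clm_comp
    ((continuous_hessMulL V).comp continuous_gramL)).const_smul α).neg

variable {f : lieAlg G → Ctrl m → lieAlg G}
  (hf : ContDiff ℝ 1 (fun p : lieAlg G × Ctrl m => f p.1 p.2))

include hf

lemma hasFDerivAt_left (p : lieAlg G × Ctrl m) :
    HasFDerivAt (fun ζ => f ζ p.2) (fderiv ℝ (fun p : lieAlg G × Ctrl m => f p.1 p.2) p ∘L
      inl ℝ (lieAlg G) (Ctrl m)) p.1 :=
  HasFDerivAt.comp (g := fun p : lieAlg G × Ctrl m => f p.1 p.2) (f := fun ζ => (ζ, p.2)) p.1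
    (hf.differentiable one_ne_zero p).hasFDerivAt (hasFDerivAt_prodMk_left p.1 p.2)

lemma hasFDerivAt_right (p : lieAlg G × Ctrl m) :
    HasFDerivAt (fun v => f p.1 v) (fderiv ℝ (fun p : lieAlg G × Ctrl m => f p.1 p.2) p ∘L
      inr ℝ (lieAlg G) (Ctrl m)) p.2 :=
  HasFDerivAt.comp (g := fun p : lieAlg G × Ctrl m => f p.1 p.2) (f := fun v => (p.1, v)) p.2
    (hf.differentiable one_ne_zero p).hasFDerivAt (hasFDerivAt_prodMk_right p.1 p.2)

lemma continuous_fderiv_left :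
    Continuous fun p : lieAlg G × Ctrl m => fderiv ℝ (fun ζ => f ζ p.2) p.1 := by
  have h : (fun p : lieAlg G × Ctrl m => fderiv ℝ (fun ζ => f ζ p.2) p.1) = fun p =>
      fderiv ℝ (fun p : lieAlg G × Ctrl m => f p.1 p.2) p ∘L inl ℝ (lieAlg G) (Ctrl m) :=
    funext fun p => (hasFDerivAt_left hf p).fderiv
  rw [h]
  exact (hf.continuous_fderiv one_ne_zero).clm_comp continuous_const

lemma continuous_fderiv_right :
    Continuous fun p : lieAlg G × Ctrl m => fderiv ℝ (fun v => f p.1 v) p.2 := by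
  have h : (fun p : lieAlg G × Ctrl m => fderiv ℝ (fun v => f p.1 v) p.2) = fun p =>
      fderiv ℝ (fun p : lieAlg G × Ctrl m => f p.1 p.2) p ∘L inr ℝ (lieAlg G) (Ctrl m) :=
    funext fun p => (hasFDerivAt_right hf p).fderiv
  rw [h]
  exact (hf.continuous_fderiv one_ne_zero).clm_comp continuous_const

variable (hfu : ∀ ξ u, (dfdu f ξ u).IsInvertible)

include hfu

lemma continuous_inverse_fderiv_right :
    Continuous fun p : lieAlg G × Ctrl m => (fderiv ℝ (fun v => f p.1 v) p.2).inverse := by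
  rw [continuous_iff_continuousAt]
  intro p
  have h : (fderiv ℝ (fun v => f p.1 v) p.2).IsInvertible := hfu p.1 p.2
  have : CompleteSpace (Ctrl m) := FiniteDimensional.complete ℝ _
  have h1 := (h.contDiffAt_map_inverse (𝕜 := ℝ) (n := 0)).continuousAt
  exact h1.comp (f := fun p : lieAlg G × Ctrl m => fderiv ℝ (fun v => f p.1 v) p.2)
    (continuous_fderiv_right hf).continuousAt

lemma continuous_feedbackL (V : Mat n → ℝ) (α : ℝ) (Kp Kd : lieAlg G →ₗ[ℝ] lieAlg G) :
    Continuous (feedbackL f V α Kp Kd) := by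
  have h1 := (continuous_inverse_fderiv_right hf hfu).comp
    (g := fun p : lieAlg G × Ctrl m => (fderiv ℝ (fun v => f p.1 v) p.2).inverse)
    (f := fun p : Mat n × Mat n × lieAlg G × Ctrl m => p.2.2) (by fun_prop)
  have h2 := (continuous_fderiv_left hf).comp
    (g := fun p : lieAlg G × Ctrl m => fderiv ℝ (fun ζ => f ζ p.2) p.1)
    (f := fun p : Mat n × Mat n × lieAlg G × Ctrl m => p.2.2) (by fun_prop)
  have h3 : Continuous fun p : Mat n × Mat n × lieAlg G × Ctrl m =>
      WL G V α (gramL p.2.1) := (continuous_WL V α).comp (continuous_gramL.comp (by fun_prop))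
  have h4 : Continuous fun p : Mat n × Mat n × lieAlg G × Ctrl m =>
      perpFieldL G V α p.2.1 := (continuous_perpFieldL V α).comp (by fun_prop)
  have h5 : Continuous fun p : Mat n × Mat n × lieAlg G × Ctrl m =>
      WL G V α (gramDotL p.2.1 p.2.2.1) := by
    refine (continuous_WL V α).comp ?_
    unfold gramDotL
    fun_prop
  unfold feedbackL adL
  refine Continuous.clm_comp h1 ?_
  fun_prop

lemma continuous_splitL (V : Mat n → ℝ) (α : ℝ) (Kp Kd : lieAlg G →ₗ[ℝ] lieAlg G) :
    Continuous (splitL f V α Kp Kd) := by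
  have h0 := continuous_feedbackL hf hfu V α Kp Kd
  have h1 := (continuous_fderiv_right hf).comp
    (g := fun p : lieAlg G × Ctrl m => fderiv ℝ (fun v => f p.1 v) p.2)
    (f := fun p : Mat n × Mat n × lieAlg G × Ctrl m => p.2.2) (by fun_prop)
  have h2 := (continuous_fderiv_left hf).comp
    (g := fun p : lieAlg G × Ctrl m => fderiv ℝ (fun ζ => f ζ p.2) p.1)
    (f := fun p : Mat n × Mat n × lieAlg G × Ctrl m => p.2.2) (by fun_prop)
  have h3 : Continuous fun p : Mat n × Mat n × lieAlg G × Ctrl m =>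
      WL G V α (gramL p.2.1) := (continuous_WL V α).comp (continuous_gramL.comp (by fun_prop))
  have h4 : Continuous fun p : Mat n × Mat n × lieAlg G × Ctrl m =>
      perpFieldL G V α p.2.1 := (continuous_perpFieldL V α).comp (by fun_prop)
  rw [continuous_clm_apply]
  intro x
  have h5 : Continuous fun p : Mat n × Mat n × lieAlg G × Ctrl m => adL G p.1 p.2.1 := by
    unfold adL; fun_prop
  exact (h4.clm_apply continuous_const).prodMk
    (((h5.clm_apply continuous_const).add (h3.clm_apply continuous_const)).prodMk
      ((h2.clm_apply continuous_const).add (h1.clm_apply (h0.clm_apply continuous_const))))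

end Continuity

lemma continuous_refData {f : lieAlg G → Ctrl m → lieAlg G} {g₀ : ℝ → G} {ξ₀ : ℝ → lieAlg G}
    {u₀ : ℝ → Ctrl m} (href : IsReference f g₀ ξ₀ u₀) : Continuous (refData g₀ ξ₀ u₀) := by
  have hg : ∀ t, HasDerivAt (fun s => mat (g₀ s)) (mat (g₀ t) * (ξ₀ t : Mat n)) t := href.deriv_g
  have hξ : ∀ t, HasDerivAt ξ₀ (f (ξ₀ t) (u₀ t)) t := href.deriv_ξ
  have h1 : Continuous fun s => mat (g₀ s) :=
    continuous_iff_continuousAt.2 fun t => (hg t).continuousAt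
  have h2 : Continuous fun s => mat (g₀ s)⁻¹ :=
    continuous_iff_continuousAt.2 fun t => (hasDerivAt_mat_inv hg t).continuousAt
  have h3 : Continuous ξ₀ := continuous_iff_continuousAt.2 fun t => (hξ t).continuousAt
  exact h1.prodMk (h2.prodMk (h3.prodMk href.continuous_u))

end Parameters

/-! ### Linearization of the nonlinear error dynamics -/

section ErrorDynamics

attribute [-instance] instTopologicalSpaceMatrix Matrix.instUniformSpace

open ContinuousLinearMap

variable {n m : ℕ} {G : Subgroup (GL (Fin n) ℝ)}

/-- The change of state `(Z, e) ↦ (Z^⊥, Z^∥, e)`. -/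
noncomputable def splitState (G : Subgroup (GL (Fin n) ℝ)) :
    (Mat n × lieAlg G) →L[ℝ] (perp G × lieAlg G × lieAlg G) :=
  (prpL G ∘L fst ℝ (Mat n) (lieAlg G)).prod
    ((prlL G ∘L fst ℝ (Mat n) (lieAlg G)).prod (snd ℝ (Mat n) (lieAlg G)))

lemma norm_le_splitState (x : Mat n × lieAlg G) : ‖x‖ ≤ 2 * ‖splitState G x‖ := by
  set y := splitState G x with hy
  have h1 : ‖y.1‖ ≤ ‖y‖ := norm_fst_le y
  have h2 : ‖y.2.1‖ ≤ ‖y‖ := (norm_fst_le y.2).trans (norm_snd_le y)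
  have h3 : ‖x.2‖ ≤ ‖y‖ := (norm_snd_le y.2).trans (norm_snd_le y)
  have h4 : (y.2.1 : Mat n) + y.1 = x.1 := prl_add_prp x.1
  refine norm_prod_le_iff.2 ⟨?_, h3.trans (by linarith [norm_nonneg y])⟩
  rw [← h4]
  refine (norm_add_le _ _).trans ?_
  have h5 : ‖(y.2.1 : Mat n)‖ = ‖y.2.1‖ := rfl
  have h6 : ‖(y.1 : Mat n)‖ = ‖y.1‖ := rfl
  linarith

/-- The nonlinear error field as a `C¹` function of the reference data, of the gain of a linear
feedback, and of the state. -/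
noncomputable def errorMap (f : lieAlg G → Ctrl m → lieAlg G) (V : Mat n → ℝ) (α : ℝ)
    (q : ((Mat n × Mat n × lieAlg G × Ctrl m) × ((Mat n × lieAlg G) →L[ℝ] Ctrl m)) ×
      (Mat n × lieAlg G)) : Mat n × lieAlg G :=
  ((1 + q.2.1) * q.1.1.1 * (q.2.2 : Mat n) * q.1.1.2.1
      - α • (grad V (1 + q.2.1) * gramL q.1.1.2.1),
    f (q.2.2 + q.1.1.2.2.1) (q.1.1.2.2.2 + q.1.2 q.2) - f q.1.1.2.2.1 q.1.1.2.2.2)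

lemma contDiff_errorMap {f : lieAlg G → Ctrl m → lieAlg G}
    (hf : ContDiff ℝ 1 (fun p : lieAlg G × Ctrl m => f p.1 p.2)) {V : Mat n → ℝ}
    (hV : ContDiff ℝ 2 V) (α : ℝ) : ContDiff ℝ 1 (errorMap f V α) := by
  have hgrad := contDiff_grad hV
  have hι : ContDiff ℝ 1 fun e : lieAlg G => (e : Mat n) := (lieAlg G).subtypeL.contDiff
  unfold errorMap gramL
  refine ContDiff.prodMk (ContDiff.sub ?_ ?_) (ContDiff.sub ?_ ?_)
  · exact (((contDiff_const.add (by fun_prop)).mul (by fun_prop)).mul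
      (hι.comp (by fun_prop))).mul (by fun_prop)
  · refine ContDiff.const_smul α (ContDiff.mul (hgrad.comp (by fun_prop)) ?_)
    exact ((transposeL n).contDiff.comp (by fun_prop)).mul (by fun_prop)
  · exact hf.comp ((ContDiff.add (by fun_prop) (by fun_prop)).prodMk
      (ContDiff.add (by fun_prop) (ContDiff.clm_apply (by fun_prop) (by fun_prop))))
  · exact hf.comp (by fun_prop)

/-- The gain of the feedback at time `t` as a function of the state `(Z, e)`, with the data of the
reference trajectory. -/
noncomputable def loopData (f : lieAlg G → Ctrl m → lieAlg G) (V : Mat n → ℝ) (α : ℝ)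
    (Kp Kd : lieAlg G →ₗ[ℝ] lieAlg G) (p : Mat n × Mat n × lieAlg G × Ctrl m) :
    (Mat n × Mat n × lieAlg G × Ctrl m) × ((Mat n × lieAlg G) →L[ℝ] Ctrl m) :=
  (p, feedbackL f V α Kp Kd p ∘L splitState G)

lemma continuous_loopData {f : lieAlg G → Ctrl m → lieAlg G}
    (hf : ContDiff ℝ 1 (fun p : lieAlg G × Ctrl m => f p.1 p.2))
    (hfu : ∀ ξ u, (dfdu f ξ u).IsInvertible) (V : Mat n → ℝ) (α : ℝ)
    (Kp Kd : lieAlg G →ₗ[ℝ] lieAlg G) : Continuous (loopData f V α Kp Kd) :=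
  continuous_id.prodMk ((continuous_feedbackL hf hfu V α Kp Kd).clm_comp continuous_const)

/-- By the right invariance of `V`, the gradient term of the error field depends on `g₀` only
through `(g₀ g₀ᵀ)⁻¹`. -/
lemma errorMap_loopData {V : Mat n → ℝ} (hV : IsTransversal G V)
    (f : lieAlg G → Ctrl m → lieAlg G) (α : ℝ)
    (Kp Kd : lieAlg G →ₗ[ℝ] lieAlg G) (g₀ : ℝ → G) (ξ₀ : ℝ → lieAlg G) (u₀ : ℝ → Ctrl m) (t : ℝ)
    (x : Mat n × lieAlg G) :
    errorMap f V α (loopData f V α Kp Kd (refData g₀ ξ₀ u₀ t), x)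
      = errorField f V α g₀ ξ₀ u₀ (feedback f V α g₀ ξ₀ u₀ Kp Kd) t x := by
  have h1 : mat (g₀ t) + x.1 * mat (g₀ t) = (1 + x.1) * mat (g₀ t) := by
    rw [Matrix.add_mul, Matrix.one_mul]
  have h2 : feedback f V α g₀ ξ₀ u₀ Kp Kd t (prp G x.1) (prl G x.1) x.2
      = (feedbackL f V α Kp Kd (refData g₀ ξ₀ u₀ t) ∘L splitState G) x :=
    (feedbackL_refData f V α Kp Kd g₀ ξ₀ u₀ t (splitState G x)).symm
  rw [errorField, h2, h1, hV.grad_mul, Matrix.mul_assoc (grad V (1 + x.1))]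
  rfl

/-- The linearization of the closed error dynamics at `0` splits into the closed split dynamics. -/
lemma splitState_fderiv_errorMap {V : Mat n → ℝ} (hV : IsTransversal G V)
    {f : lieAlg G → Ctrl m → lieAlg G}
    (hf : ContDiff ℝ 1 (fun p : lieAlg G × Ctrl m => f p.1 p.2)) (α : ℝ)
    (Kp Kd : lieAlg G →ₗ[ℝ] lieAlg G) (g₀ : ℝ → G) (ξ₀ : ℝ → lieAlg G) (u₀ : ℝ → Ctrl m) (t : ℝ)
    (x : Mat n × lieAlg G) :
    splitState G (fderiv ℝ
        (fun y => errorMap f V α (loopData f V α Kp Kd (refData g₀ ξ₀ u₀ t), y)) 0 x)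
      = splitField f V α g₀ ξ₀ u₀ (feedback f V α g₀ ξ₀ u₀ Kp Kd) t (splitState G x) := by
  set p := refData g₀ ξ₀ u₀ t with hp
  set κ := feedbackL f V α Kp Kd p ∘L splitState G with hκ
  set w : Ctrl m := κ x with hw
  have hline : HasDerivAt (fun s : ℝ => s • x) x 0 := by
    simpa using (hasDerivAt_id (0 : ℝ)).smul_const x
  have hD1 : HasDerivAt (fun s : ℝ => errorMap f V α (loopData f V α Kp Kd p, s • x))
      (fderiv ℝ (fun y => errorMap f V α (loopData f V α Kp Kd p, y)) 0 x) 0 := by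
    have h1 : HasFDerivAt (fun y => errorMap f V α (loopData f V α Kp Kd p, y))
        (fderiv ℝ (fun y => errorMap f V α (loopData f V α Kp Kd p, y)) 0) ((0 : ℝ) • x) := by
      rw [zero_smul]
      exact ((((contDiff_errorMap hf hV.contDiff α).comp
        (contDiff_prodMk_right (loopData f V α Kp Kd p))).differentiable one_ne_zero) 0).hasFDerivAt
    exact h1.comp_hasDerivAt (0 : ℝ) hline
  have hZ : HasDerivAt (fun s : ℝ => 1 + s • x.1) x.1 0 := by
    simpa using ((hasDerivAt_id (0 : ℝ)).smul_const x.1).const_add 1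
  have he : HasDerivAt (fun s : ℝ => s • (x.2 : Mat n)) (x.2 : Mat n) 0 := by
    simpa using (hasDerivAt_id (0 : ℝ)).smul_const (x.2 : Mat n)
  have hA : HasDerivAt
      (fun s : ℝ => (1 + s • x.1) * mat (g₀ t) * (s • (x.2 : Mat n)) * mat (g₀ t)⁻¹)
      (Ad (g₀ t) x.2 : lieAlg G) 0 := by
    refine (((hZ.mul_const (mat (g₀ t))).mul he).mul_const (mat (g₀ t)⁻¹)).congr_deriv ?_
    simp [Ad]
  have hB : HasDerivAt (fun s : ℝ => grad V (1 + s • x.1)) (hess V 1 x.1) 0 := by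
    have h1 : HasFDerivAt (grad V) (hess V 1) (1 + (0 : ℝ) • x.1) := by
      rw [zero_smul, add_zero]
      exact ((contDiff_grad hV.contDiff).differentiable one_ne_zero 1).hasFDerivAt
    exact HasFDerivAt.comp_hasDerivAt (l := grad V) (0 : ℝ) h1 hZ
  have hC : HasDerivAt (fun s : ℝ => f (s • x.2 + ξ₀ t) (u₀ t + κ (s • x)))
      (fderiv ℝ (fun ζ => f ζ (u₀ t)) (ξ₀ t) x.2 + fderiv ℝ (fun v => f (ξ₀ t) v) (u₀ t) w) 0 := by
    have h1 : HasFDerivAt (fun p : lieAlg G × Ctrl m => f p.1 p.2)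
        (fderiv ℝ (fun p : lieAlg G × Ctrl m => f p.1 p.2) (ξ₀ t, u₀ t))
        ((0 : ℝ) • x.2 + ξ₀ t, u₀ t + κ ((0 : ℝ) • x)) := by
      rw [zero_smul, zero_smul, map_zero, zero_add, add_zero]
      exact (hf.differentiable one_ne_zero _).hasFDerivAt
    have h2 : HasDerivAt (fun s : ℝ => s • x.2 + ξ₀ t) x.2 0 := by
      simpa using ((hasDerivAt_id (0 : ℝ)).smul_const x.2).add_const (ξ₀ t)
    have h3 : HasDerivAt (fun s : ℝ => u₀ t + κ (s • x)) w 0 :=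
      (κ.hasFDerivAt.comp_hasDerivAt (0 : ℝ) hline).const_add (u₀ t)
    have h4 := h1.comp_hasDerivAt (0 : ℝ) (h2.prodMk h3)
    refine h4.congr_deriv ?_
    rw [(hasFDerivAt_left hf (ξ₀ t, u₀ t)).fderiv, (hasFDerivAt_right hf (ξ₀ t, u₀ t)).fderiv,
      ContinuousLinearMap.comp_apply, ContinuousLinearMap.comp_apply, ← map_add, inl_apply,
      inr_apply, Prod.mk_add_mk, add_zero, zero_add]
  have hD2 : HasDerivAt (fun s : ℝ => errorMap f V α (loopData f V α Kp Kd p, s • x))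
      ((Ad (g₀ t) x.2 : Mat n) - α • (hess V 1 x.1 * gramL (mat (g₀ t)⁻¹)),
        fderiv ℝ (fun ζ => f ζ (u₀ t)) (ξ₀ t) x.2 + fderiv ℝ (fun v => f (ξ₀ t) v) (u₀ t) w) 0 :=
    (hA.sub ((hB.mul_const (gramL (mat (g₀ t)⁻¹))).const_smul α)).prodMk
      (hC.sub_const (f (ξ₀ t) (u₀ t)))
  rw [hD1.unique hD2, gramL_eq]
  have hw' : w = feedback f V α g₀ ξ₀ u₀ Kp Kd t (prp G x.1) (prl G x.1) x.2 :=
    feedbackL_refData f V α Kp Kd g₀ ξ₀ u₀ t (splitState G x)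
  have h1 : prp G ((Ad (g₀ t) x.2 : Mat n) - α • (hess V 1 x.1 * gramInv g₀ t))
      = perpField V α g₀ t (prp G x.1) := by
    rw [map_sub, prp_lieAlg, zero_sub, map_smul, perpField, hV.hess_prp]
  have h2 : prl G ((Ad (g₀ t) x.2 : Mat n) - α • (hess V 1 x.1 * gramInv g₀ t))
      = Ad (g₀ t) x.2 - α • prl G (hess V 1 (prp G x.1 : Mat n) * gramInv g₀ t) := by
    rw [map_sub, prl_coe, map_smul, hV.hess_prp]
  refine Prod.ext h1 (Prod.ext h2 ?_)
  rw [hw']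
  rfl

end ErrorDynamics

/-! ### Stability of the closed loop -/

section ClosedLoop

attribute [-instance] instTopologicalSpaceMatrix Matrix.instUniformSpace

variable {n m : ℕ} {G : Subgroup (GL (Fin n) ℝ)} {V : Mat n → ℝ} {α : ℝ}
  {f : lieAlg G → Ctrl m → lieAlg G} {g₀ : ℝ → G} {ξ₀ : ℝ → lieAlg G} {u₀ : ℝ → Ctrl m}
  {Kp Kd : Mat n}

lemma hasDerivAt_W (href : IsReference f g₀ ξ₀ u₀) (V : Mat n → ℝ) (α : ℝ) {η : ℝ → perp G} {t : ℝ}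
    (hη : HasDerivAt η (perpField V α g₀ t (η t)) t) :
    HasDerivAt (fun s => W V α g₀ s (η s)) (Wdot V α g₀ ξ₀ t (η t)) t := by
  rw [Wdot_eq, ← hasDerivWithinAt_univ]
  exact hasDerivWithinAt_W href.deriv_g V α hη.hasDerivWithinAt

lemma globallyExpStable_splitField (hV : IsTransversal G V) (hα : 0 < α)
    (hf : ContDiff ℝ 1 (fun p : lieAlg G × Ctrl m => f p.1 p.2))
    (hfu : ∀ ξ u, (dfdu f ξ u).IsInvertible) (href : IsReference f g₀ ξ₀ u₀)
    {C : ℝ} (hC0 : 0 < C) (hC : ∀ t, ‖mat (g₀ t)‖ ≤ C ∧ ‖mat (g₀ t)⁻¹‖ ≤ C)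
    (hKp : ∀ X ∈ lieAlg G, Kp * X ∈ lieAlg G) (hKd : ∀ X ∈ lieAlg G, Kd * X ∈ lieAlg G)
    (hK : IsHurwitz (Matrix.fromBlocks 0 1 Kp Kd)) :
    GloballyExpStable (splitField f V α g₀ ξ₀ u₀
      (feedback f V α g₀ ξ₀ u₀ (leftMul Kp hKp) (leftMul Kd hKd))) := by
  obtain ⟨v, dv, c, k, l, ε, hc, hk, hl, hε, hv, hlow, hup, hdec⟩ :=
    exists_lyapunov_splitField hV hα hfu u₀ href.deriv_g hC0 hC hKp hKd hK
  have hA : Continuous fun t => splitL f V α (leftMul Kp hKp) (leftMul Kd hKd)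
      (refData g₀ ξ₀ u₀ t) := (continuous_splitL hf hfu V α _ _).comp (continuous_refData href)
  refine globallyExpStable_of_lyapunov hA (splitL_refData f V α _ _ g₀ ξ₀ u₀) hc hk hl hv hlow hup
    fun t x => ?_
  have h := hdec t x 0 (by rw [norm_zero]; positivity)
  rwa [add_zero] at h

lemma isBounded_loopData (hf : ContDiff ℝ 1 (fun p : lieAlg G × Ctrl m => f p.1 p.2))
    (hfu : ∀ ξ u, (dfdu f ξ u).IsInvertible)
    {C : ℝ} (hC : ∀ t, ‖mat (g₀ t)‖ ≤ C ∧ ‖mat (g₀ t)⁻¹‖ ≤ C)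
    (hξ : Bornology.IsBounded (Set.range ξ₀)) (hu : Bornology.IsBounded (Set.range u₀))
    (V : Mat n → ℝ) (α : ℝ) (kp kd : lieAlg G →ₗ[ℝ] lieAlg G) :
    Bornology.IsBounded (Set.range fun t => loopData f V α kp kd (refData g₀ ξ₀ u₀ t)) := by
  obtain ⟨Q, hQ⟩ := hξ.exists_norm_le
  obtain ⟨Q', hQ'⟩ := hu.exists_norm_le
  -- the reference data stay in a ball, whose image under a continuous map is bounded
  refine isBounded_image_of_continuous (Ψ := loopData f V α kp kd) (p := refData g₀ ξ₀ u₀)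
    (continuous_loopData hf hfu V α kp kd) (max C (max C (max Q Q'))) fun t => ?_
  exact max_le_max (hC t).1 (max_le_max (hC t).2
    (max_le_max (hQ _ ⟨t, rfl⟩) (hQ' _ ⟨t, rfl⟩)))

lemma expStable_errorField (hV : IsTransversal G V) (hα : 0 < α)
    (hf : ContDiff ℝ 1 (fun p : lieAlg G × Ctrl m => f p.1 p.2))
    (hfu : ∀ ξ u, (dfdu f ξ u).IsInvertible) (href : IsReference f g₀ ξ₀ u₀)
    {C : ℝ} (hC0 : 0 < C) (hC : ∀ t, ‖mat (g₀ t)‖ ≤ C ∧ ‖mat (g₀ t)⁻¹‖ ≤ C)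
    (hKp : ∀ X ∈ lieAlg G, Kp * X ∈ lieAlg G) (hKd : ∀ X ∈ lieAlg G, Kd * X ∈ lieAlg G)
    (hK : IsHurwitz (Matrix.fromBlocks 0 1 Kp Kd))
    (hξ : Bornology.IsBounded (Set.range ξ₀)) (hu : Bornology.IsBounded (Set.range u₀)) :
    ExpStable (errorField f V α g₀ ξ₀ u₀
      (feedback f V α g₀ ξ₀ u₀ (leftMul Kp hKp) (leftMul Kd hKd))) := by
  obtain ⟨v, dv, c, k, l, ε, hc, hk, hl, hε, hv, hlow, hup, hdec⟩ :=
    exists_lyapunov_splitField hV hα hfu u₀ href.deriv_g hC0 hC hKp hKd hK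
  refine expStable_of_lyapunov_linearization (contDiff_errorMap hf hV.contDiff α)
    ((continuous_loopData hf hfu V α (leftMul Kp hKp) (leftMul Kd hKd)).comp
      (continuous_refData href))
    (isBounded_loopData hf hfu hC hξ hu V α _ _) (errorMap_loopData hV f α _ _ g₀ ξ₀ u₀)
    (fun t => ?_) two_pos norm_le_splitState
    (splitState_fderiv_errorMap hV hf α _ _ g₀ ξ₀ u₀) hc hk hl hε hv hlow hup hdec
  simp [errorMap, hV.grad_one]

end ClosedLoop

end LieTracking

theorem theorem2 {n m : ℕ} (G : Subgroup (GL (Fin n) ℝ))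
    (hG : IsClosed (G : Set (GL (Fin n) ℝ)))
    (V : LieTracking.Mat n → ℝ) (hV : LieTracking.IsTransversal G V) (α : ℝ) (hα : 0 < α)
    (f : LieTracking.lieAlg G → LieTracking.Ctrl m → LieTracking.lieAlg G)
    (hf : ContDiff ℝ 1 (fun p : LieTracking.lieAlg G × LieTracking.Ctrl m => f p.1 p.2))
    (hfu : ∀ ξ u, (LieTracking.dfdu f ξ u).IsInvertible)
    (g₀ : ℝ → G) (ξ₀ : ℝ → LieTracking.lieAlg G) (u₀ : ℝ → LieTracking.Ctrl m)
    (href : LieTracking.IsReference f g₀ ξ₀ u₀)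
    (hg₀ : ∃ a b : ℝ, 0 < a ∧ a ≤ b ∧ ∀ t,
      (LieTracking.mat (g₀ t) * (LieTracking.mat (g₀ t))ᵀ
        - a • (1 : LieTracking.Mat n)).PosSemidef ∧
      (b • (1 : LieTracking.Mat n)
        - LieTracking.mat (g₀ t) * (LieTracking.mat (g₀ t))ᵀ).PosSemidef)
    (Kp Kd : LieTracking.Mat n)
    (hKp : ∀ X ∈ LieTracking.lieAlg G, Kp * X ∈ LieTracking.lieAlg G)
    (hKd : ∀ X ∈ LieTracking.lieAlg G, Kd * X ∈ LieTracking.lieAlg G)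
    (hK : LieTracking.IsHurwitz (Matrix.fromBlocks 0 1 Kp Kd)) :
    -- the closed-loop split linearized dynamics is exponentially stable
    LieTracking.GloballyExpStable
      (LieTracking.splitField f V α g₀ ξ₀ u₀
        (LieTracking.feedback f V α g₀ ξ₀ u₀ (LieTracking.leftMul Kp hKp)
          (LieTracking.leftMul Kd hKd))) ∧
    -- `Wdot` is the time derivative of `W` along the transversal dynamics
    (∀ (η : ℝ → LieTracking.perp G) (t : ℝ),
      HasDerivAt η (LieTracking.perpField V α g₀ t (η t)) t →
      HasDerivAt (fun s => LieTracking.W V α g₀ s (η s))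
        (LieTracking.Wdot V α g₀ ξ₀ t (η t)) t) ∧
    -- the closed-loop nonlinear error dynamics is exponentially stable
    (Bornology.IsBounded (Set.range ξ₀) → Bornology.IsBounded (Set.range u₀) →
      LieTracking.ExpStable
        (LieTracking.errorField f V α g₀ ξ₀ u₀
          (LieTracking.feedback f V α g₀ ξ₀ u₀ (LieTracking.leftMul Kp hKp)
            (LieTracking.leftMul Kd hKd)))) := by
  obtain ⟨C, hC0, hC⟩ := LieTracking.exists_norm_mat_le hg₀
  exact ⟨LieTracking.globallyExpStable_splitField hV hα hf hfu href hC0 hC hKp hKd hK,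
    fun η t hη => LieTracking.hasDerivAt_W href V α hη,
    LieTracking.expStable_errorField hV hα hf hfu href hC0 hC hKp hKd hK⟩
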